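/- **Conventions.** Fix $\rho>1$. Let $\mathcal W$ be the Banach space of functions $f(\lambda)=\sum_{i\in\mathbb Z}c_i\lambda^i$ on the unit circle $\mathbb S^1$ with $\|f\|=\sum_i|c_i|\rho^{|i|}<\infty$; write $f^0=c_0$. Let $D(0,R)$ and $D^*(0,R)$ be the disk and the punctured disk in the $z$-plane ($R>0$), and $p:\widetilde{D^*}(0,R)\to D^*(0,R)$ the universal cover. A *DPW potential* on $D^*(0,R)$ is a matrix-valued 1-form $\xi(z,\lambda)=\begin{pmatrix}\alpha&\lambda^{-1}\beta\\ \gamma&-\alpha\end{pmatrix}$ with entries in $\mathcal W$ as functions of $\lambda$, where $\alpha,\beta,\gamma$ are 1-forms holomorphic in $z\in D^*(0,R)$ which depend holomorphically on $\lambda$ in the disk $|\lambda|<\rho$ (that is, they have no negative powers of $\lambda$). The catenoid potential is $\xi^C=\begin{pmatrix}0&0\\1&0\end{pmatrix}dz$. A map $\Phi:\widetilde{D^*}(0,R)\to SL(2,\mathcal W)$ *solves the Monodromy Problem* if for every deck transformation $\sigma$ of the universal cover, the monodromy $\mathcal M(\lambda)=\Phi(\sigma(\widetilde z),\lambda)\Phi(\widetilde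 z,\lambda)^{-1}$ satisfies $\mathcal M(\lambda)\in SU(2)$ for all $\lambda\in\mathbb S^1$, $\mathcal M(1)=\pm I_2$ and $\frac{\partial\mathcal M}{\partial\lambda}(1)=0$. (When $d\Phi=\Phi\xi$, $\mathcal M$ does not depend on $\widetilde z$.) **Theorem.** Let $\epsilon>0$ and, for $t\in(-\epsilon,\epsilon)$, let $\xi_t$ be DPW potentials on $D^*(0,R)$ such that $(t,z)\mapsto\xi_t(z,\cdot)$ is $C^1$ with values in $\mathfrak{sl}(2,\mathcal W)$, and let $\Phi_t$ be solutions of $d\Phi_t=\Phi_t\,p^*\xi_t$ on $\widetilde{D^*}(0,R)$ such that $(t,\widetilde z)\mapsto\Phi_t(\widetilde z,\cdot)$ is $C^1$ with values in $SL(2,\mathcal W)$. Let $\widetilde z_0\in\widetilde{D^*}(0,R)$. Assume that: 1. $\xi_0=\xi^C$. 2. For $t\neq0$, $\xi_t$ has at most a triple pole at $z=0$, with principal part given by $$\xi_t(z,\lambda)=\begin{pmatrix}0&\lambda^{-1}\\0&0\end{pmatrix}\left(\frac{a_t}{z^3}+\frac{b_t}{z^2}+\frac{c_t}{z}\right)dz+\Xi_t(z,\lambda),$$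 where $a_t,b_t,c_t\in\mathcal W$ and $\Xi_t$ is holomorphic in $D(0,R)$. 3. $\Phi_0(\widetilde z_0,\cdot)$ extends holomorphically to the annulus $\{\rho'^{-1}<|\lambda|<\rho'\}$ for some $\rho'>\rho$. 4. For all $t\neq0$, $\Phi_t$ solves the Monodromy Problem. 5. For all $t\neq0$, $a_t^0=0$ and $\operatorname{Re}(b_t^0)=0$. Then there is $\delta\in(0,\epsilon]$ such that for $|t|<\delta$, $t\neq0$, one has $a_t=b_t=c_t=0$; so, for $|t|<\delta$, $\xi_t$ extends holomorphically to $z=0$. -/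

import Mathlib

open Set

noncomputable section

namespace DPW

/-! ### The weighted Wiener algebra -/

/-- The two-sided sequences `(c i)` of Fourier coefficients for which
`∑ i, |c i| * ρ ^ |i|` is finite. -/
def wienerSubmodule (ρ : ℝ) : Submodule ℂ (ℤ → ℂ) where
  carrier := {c | Summable fun i : ℤ => ‖c i‖ * |ρ| ^ i.natAbs}
  zero_mem' := by simp
  add_mem' := by
    intro c d hc hd
    refine Summable.of_nonneg_of_le (fun i => by positivity) (fun i => ?_) (Summable.add hc hd)
    rw [← add_mul]
    exact mul_le_mul_of_nonneg_right (norm_add_le _ _) (by positivity)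
  smul_mem' := by
    intro k c hc
    refine (Summable.mul_left ‖k‖ hc).congr (fun i => ?_)
    simp [mul_assoc]

/-- The space `𝓦` of functions `f(λ) = ∑ i, c i * λ ^ i` on the unit circle with
`‖f‖ = ∑ i, |c i| * ρ ^ |i|` finite; a function is represented by its Fourier coefficients.
It is used for `ρ > 1` only. -/
def W (ρ : ℝ) : Type := wienerSubmodule ρ

namespace W

variable {ρ : ℝ}

instance : AddCommGroup (W ρ) := inferInstanceAs (AddCommGroup (wienerSubmodule ρ))

instance : Module ℂ (W ρ) := inferInstanceAs (Module ℂ (wienerSubmodule ρ))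

/-- The Fourier coefficient of `λ ^ i`. -/
def coeff (f : W ρ) (i : ℤ) : ℂ := f.1 i

theorem summable_coeff (f : W ρ) : Summable fun i : ℤ => ‖f.coeff i‖ * |ρ| ^ i.natAbs := f.2

/-- The norm `∑ i, |c i| * ρ ^ |i|` (recall `ρ > 1`). -/
instance : Norm (W ρ) := ⟨fun f => ∑' i : ℤ, ‖f.coeff i‖ * |ρ| ^ i.natAbs⟩

theorem norm_def (f : W ρ) : ‖f‖ = ∑' i : ℤ, ‖f.coeff i‖ * |ρ| ^ i.natAbs := rfl

theorem core [hρ : Fact (1 < ρ)] : NormedSpace.Core ℂ (W ρ) where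
  norm_nonneg f := tsum_nonneg fun i => by positivity
  norm_smul k f := by
    rw [norm_def, norm_def, ← tsum_mul_left]
    refine tsum_congr fun i => ?_
    have h : (k • f).coeff i = k * f.coeff i := rfl
    rw [h, norm_mul, mul_assoc]
  norm_triangle f g := by
    rw [norm_def, norm_def, norm_def, ← f.summable_coeff.tsum_add g.summable_coeff]
    refine (f + g).summable_coeff.tsum_le_tsum (fun i => ?_)
      (f.summable_coeff.add g.summable_coeff)
    have h : (f + g).coeff i = f.coeff i + g.coeff i := rfl
    rw [h, ← add_mul]
    exact mul_le_mul_of_nonneg_right (norm_add_le _ _) (by positivity)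
  norm_eq_zero_iff f := by
    have hpos : 0 < |ρ| := abs_pos.2 (by linarith [hρ.out])
    constructor
    · intro h
      have h0 := (hasSum_zero_iff_of_nonneg (fun i => by positivity)).1
        (h ▸ f.summable_coeff.hasSum : HasSum (fun i : ℤ => ‖f.coeff i‖ * |ρ| ^ i.natAbs) 0)
      refine Subtype.ext (funext fun i => ?_)
      have hi := congrFun h0 i
      have hne : |ρ| ^ i.natAbs ≠ 0 := (pow_pos hpos _).ne'
      exact norm_eq_zero.1 ((mul_eq_zero.1 hi).resolve_right hne)
    · rintro rfl
      have h : ∀ i, (0 : W ρ).coeff i = 0 := fun _ => rfl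
      simp [norm_def, h]

instance [Fact (1 < ρ)] : NormedAddCommGroup (W ρ) := NormedAddCommGroup.ofCore core

instance [Fact (1 < ρ)] : NormedSpace ℂ (W ρ) := NormedSpace.ofCore core

/-- The value at `lam` of the Laurent series; it converges for `ρ⁻¹ ≤ |lam| ≤ ρ`. -/
def eval (f : W ρ) (lam : ℂ) : ℂ := ∑' i : ℤ, f.coeff i * lam ^ i

end W

/-! ### Matrix-valued loops and potentials -/

/-- `2 × 2` matrices with entries in `𝓦`. -/
abbrev LoopMatrix (ρ : ℝ) : Type := Matrix (Fin 2) (Fin 2) (W ρ)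

/-- The value of a matrix-valued loop at `lam`. -/
def LoopMatrix.eval {ρ : ℝ} (A : LoopMatrix ρ) (lam : ℂ) : Matrix (Fin 2) (Fin 2) ℂ :=
  A.map fun f => f.eval lam

/-- `A ∈ SL(2, 𝓦)`. -/
def LoopMatrix.IsSL {ρ : ℝ} (A : LoopMatrix ρ) : Prop :=
  ∀ lam : ℂ, ‖lam‖ = 1 → (A.eval lam).det = 1

/-- The matrix-valued loop extends holomorphically to the annulus `ρ'⁻¹ < |lam| < ρ'`. -/
def LoopMatrix.IsHolomorphicInAnnulus {ρ : ℝ} (A : LoopMatrix ρ) (ρ' : ℝ) : Prop :=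
  ∃ g : ℂ → Matrix (Fin 2) (Fin 2) ℂ,
    (∀ i j, DifferentiableOn ℂ (fun lam => g lam i j) {lam | ρ'⁻¹ < ‖lam‖ ∧ ‖lam‖ < ρ'}) ∧
    ∀ lam : ℂ, ‖lam‖ = 1 → A.eval lam = g lam

/-- A map into matrices over `𝓦` is holomorphic on `U`. -/
def IsHolomorphicOn {ρ : ℝ} [Fact (1 < ρ)] (U : Set ℂ) (A : ℂ → LoopMatrix ρ) : Prop :=
  ∀ i j, DifferentiableOn ℂ (fun z => A z i j) U

/-- `(t, z) ↦ A t z` is `C¹` on `(-ε, ε) × U` with values in matrices over `𝓦`. -/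
def IsC1Family {ρ : ℝ} [Fact (1 < ρ)] (ε : ℝ) (U : Set ℂ) (A : ℝ → ℂ → LoopMatrix ρ) : Prop :=
  ∀ i j, ContDiffOn ℝ 1 (fun p : ℝ × ℂ => A p.1 p.2 i j) (Ioo (-ε) ε ×ˢ U)

/-- A DPW potential `(α, λ⁻¹ β; γ, -α)` on `U ⊆ ℂ`, written as the coefficient of `dz`: it is
holomorphic in `z`, trace free, and `α`, `β`, `γ` are holomorphic in `λ` in the disk of radius
`ρ`, that is, the Laurent series of `α` and `γ` start at `λ⁰` and that of `λ⁻¹ β` at `λ⁻¹`. -/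
structure IsDPWPotential {ρ : ℝ} [Fact (1 < ρ)] (U : Set ℂ) (ξ : ℂ → LoopMatrix ρ) : Prop where
  holomorphic : IsHolomorphicOn U ξ
  trace_zero : ∀ z ∈ U, ξ z 1 1 = -ξ z 0 0
  alpha_nonneg : ∀ z ∈ U, ∀ i : ℤ, i < 0 → (ξ z 0 0).coeff i = 0
  beta_nonneg : ∀ z ∈ U, ∀ i : ℤ, i < -1 → (ξ z 0 1).coeff i = 0
  gamma_nonneg : ∀ z ∈ U, ∀ i : ℤ, i < 0 → (ξ z 1 0).coeff i = 0

/-! ### The punctured disk, its universal cover, and the Monodromy Problem -/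

/-- The punctured disk `D*(0, R)`. -/
def puncturedDisk (R : ℝ) : Set ℂ := {z | z ≠ 0 ∧ ‖z‖ < R}

/-- The universal cover of `D*(0, R)`: the half-plane `exp ⁻¹' D*(0, R)`, the covering map being
`w ↦ exp w`. -/
def cover (R : ℝ) : Set ℂ := {w | Complex.exp w ∈ puncturedDisk R}

/-- `Φ` solves `dΦ = Φ ξ` on the universal cover. As `z = exp w`, the lift of `ξ(z) dz` is
`exp w * ξ(exp w) dw`. -/
def IsSolution {ρ : ℝ} (R : ℝ) (ξ Φ : ℂ → LoopMatrix ρ) : Prop :=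
  ∀ w ∈ cover R, ∀ lam : ℂ, ‖lam‖ = 1 → ∀ i j,
    HasDerivAt (fun w' => (Φ w').eval lam i j)
      ((Complex.exp w • ((Φ w).eval lam * (ξ (Complex.exp w)).eval lam)) i j) w

/-- A deck transformation of the universal cover of `D*(0, R)`. -/
def IsDeck (R : ℝ) (σ : cover R ≃ₜ cover R) : Prop :=
  ∀ w : cover R, Complex.exp (σ w : ℂ) = Complex.exp (w : ℂ)

/-- The monodromy `Φ(σ(w), lam) * Φ(w, lam)⁻¹` (independent of `w` if `Φ` is a solution). -/
def monodromy {ρ R : ℝ} (Φ : ℂ → LoopMatrix ρ) (σ : cover R ≃ₜ cover R) (w : cover R) (lam : ℂ) :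
    Matrix (Fin 2) (Fin 2) ℂ :=
  (Φ (σ w)).eval lam * ((Φ w).eval lam)⁻¹

/-- `Φ` solves the Monodromy Problem: for each deck transformation the monodromy is unitary on the
unit circle, equals `±1` at `lam = 1`, and has vanishing derivative in `lam` there. -/
def SolvesMonodromyProblem {ρ : ℝ} (R : ℝ) (Φ : ℂ → LoopMatrix ρ) : Prop :=
  ∀ σ : cover R ≃ₜ cover R, IsDeck R σ → ∀ w : cover R,
    (∀ lam : ℂ, ‖lam‖ = 1 → monodromy Φ σ w lam ∈ Matrix.specialUnitaryGroup (Fin 2) ℂ) ∧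
    (monodromy Φ σ w 1 = 1 ∨ monodromy Φ σ w 1 = -1) ∧
    ∀ i j, HasDerivAt (fun lam => monodromy Φ σ w lam i j) 0 1

/-- `ξ` has at most a triple pole at `z = 0`, with principal part
`(0, λ⁻¹; 0, 0) (a / z³ + b / z² + c / z) dz`: the remainder is holomorphic in `D(0, R)`. -/
def HasPrincipalPart {ρ : ℝ} [Fact (1 < ρ)] (R : ℝ) (ξ : ℂ → LoopMatrix ρ) (a b c : W ρ) : Prop :=
  ∃ Ξ : ℂ → LoopMatrix ρ, IsHolomorphicOn (Metric.ball 0 R) Ξ ∧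
    ∀ z ∈ puncturedDisk R, ∀ lam : ℂ, ‖lam‖ = 1 →
      (ξ z).eval lam =
        (a.eval lam / z ^ 3 + b.eval lam / z ^ 2 + c.eval lam / z) • !![0, lam⁻¹; 0, 0] +
          (Ξ z).eval lam

end DPW

end

/-! Write `τ = ‖a‖ + ‖b‖ + ‖c‖` for the size of the principal part at a given `t`. The proof
compares an upper and a lower bound of order `τ`; nothing is expanded in powers of `t`, and `t → 0`
serves only to make the potential and the solution uniformly close to the catenoid data.

Upper bound (`exists_norm_monodromy_sub_le`): write the potential as `N + P + h`, with `N` the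
catenoid matrix (so `N² = 0`), `P` the polar part and `h` holomorphic in the disk. The adjoint
equation `U' = -(N + h) U` has a single-valued solution near `1 - z N`, and `(φ U)' = φ P U`
contains only the polar part. Since the unperturbed solution is `G (1 + z N)`, integration around
the circle gives `M - 1 = S + o(τ)`, where `S = G X G⁻¹` and `X = 2πi λ⁻¹ (-b, c; -a, b)` is
`residueLoop`. The Monodromy Problem makes the trace-free part of `M` antihermitian and zero to
second order at `λ = 1`, so `S` has these properties up to `o(τ)`; `defect` measures the failure.

Rigidity (`residueLoop_eq_zero_of_antihermitian`): if `S` has these properties exactly, `det S =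
-4π² λ⁻² (ac - b²)` is real on the circle, of degrees `-2` to `2`, and `o((λ - 1)²)`, hence equals
`k (λ - 1)⁴ / λ²`. The normalization of `a⁰` and `b⁰` gives `k = -4π² (Im b⁰)² ≤ 0`, while `det S ≥
0` at `λ = -1`, where its value is `16 k`. So `det S = 0`, which forces `S = 0`.

Lower bound (`exists_norm_le_mul_defect`): rigidity becomes `τ ≤ C * defect S` by compactness. The
loop `X` has degrees at least `-1`; if `S` is nearly antihermitian, the part of `X` in degrees at
least `2` is, up to a small error, a sum of Hankel operators applied to `X*`, and these are compact
on `𝓦`. The two bounds give `τ ≤ τ / 2`, so `τ = 0`. -/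

open Set

noncomputable section

namespace DPW

/-! ### Fourier coefficients and completeness of `𝓦`. -/

namespace W

variable {ρ : ℝ}

/-- The weight `ρ ^ |i|` of the `i`-th Fourier coefficient. -/
def weight (ρ : ℝ) (i : ℤ) : ℝ := |ρ| ^ i.natAbs

theorem weight_zero : weight ρ 0 = 1 := by simp [weight]

theorem weight_neg (i : ℤ) : weight ρ (-i) = weight ρ i := by simp [weight]

theorem weight_nonneg (i : ℤ) : 0 ≤ weight ρ i := by unfold weight; positivity

theorem one_le_weight [hρ : Fact (1 < ρ)] (i : ℤ) : 1 ≤ weight ρ i :=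
  one_le_pow₀ (hρ.out.le.trans (le_abs_self ρ))

theorem weight_pos [Fact (1 < ρ)] (i : ℤ) : 0 < weight ρ i :=
  zero_lt_one.trans_le (one_le_weight i)

theorem weight_add_le [hρ : Fact (1 < ρ)] (i j : ℤ) :
    weight ρ (i + j) ≤ weight ρ i * weight ρ j := by
  rw [weight, weight, weight, ← pow_add]
  exact pow_le_pow_right₀ (hρ.out.le.trans (le_abs_self ρ)) (Int.natAbs_add_le i j)

theorem summable_weight (f : W ρ) : Summable fun i : ℤ => ‖f.coeff i‖ * weight ρ i :=
  f.summable_coeff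

theorem norm_eq (f : W ρ) : ‖f‖ = ∑' i : ℤ, ‖f.coeff i‖ * weight ρ i := rfl

/-- The element of `𝓦` with given Fourier coefficients. -/
def mk (c : ℤ → ℂ) (hc : Summable fun i : ℤ => ‖c i‖ * weight ρ i) : W ρ := ⟨c, hc⟩

@[simp]
theorem coeff_mk (c : ℤ → ℂ) (hc : Summable fun i : ℤ => ‖c i‖ * weight ρ i) (i : ℤ) :
    (mk c hc).coeff i = c i := rfl

@[ext]
theorem ext {f g : W ρ} (h : ∀ i, f.coeff i = g.coeff i) : f = g :=
  Subtype.ext (funext h)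

@[simp] theorem coeff_zero (i : ℤ) : (0 : W ρ).coeff i = 0 := rfl

@[simp] theorem coeff_add (f g : W ρ) (i : ℤ) : (f + g).coeff i = f.coeff i + g.coeff i := rfl

@[simp] theorem coeff_neg (f : W ρ) (i : ℤ) : (-f).coeff i = -f.coeff i := rfl

@[simp] theorem coeff_sub (f g : W ρ) (i : ℤ) : (f - g).coeff i = f.coeff i - g.coeff i := rfl

@[simp] theorem coeff_smul (k : ℂ) (f : W ρ) (i : ℤ) : (k • f).coeff i = k * f.coeff i := rfl

theorem norm_coeff_mul_weight_le (f : W ρ) (i : ℤ) : ‖f.coeff i‖ * weight ρ i ≤ ‖f‖ :=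
  f.summable_weight.le_tsum i fun _ _ => mul_nonneg (norm_nonneg _) (weight_nonneg _)

theorem norm_coeff_le [Fact (1 < ρ)] (f : W ρ) (i : ℤ) : ‖f.coeff i‖ ≤ ‖f‖ :=
  (le_mul_of_one_le_right (norm_nonneg _) (one_le_weight i)).trans (f.norm_coeff_mul_weight_le i)

/-- The `i`-th Fourier coefficient as a continuous linear functional. -/
def coeffL [Fact (1 < ρ)] (i : ℤ) : W ρ →L[ℂ] ℂ :=
  LinearMap.mkContinuous
    { toFun := fun f => f.coeff i
      map_add' := fun _ _ => rfl
      map_smul' := fun _ _ => rfl } 1 fun f => by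
      rw [one_mul]
      exact f.norm_coeff_le i

@[simp] theorem coeffL_apply [Fact (1 < ρ)] (i : ℤ) (f : W ρ) : coeffL i f = f.coeff i := rfl

/-- The rescaled coefficients `c i * ρ ^ |i|` as an element of `ℓ¹`. -/
def toLp (f : W ρ) : lp (fun _ : ℤ => ℂ) 1 :=
  ⟨fun i => f.coeff i * weight ρ i, by
    refine (memℓp_gen_iff (by simp)).2 ?_
    refine f.summable_weight.congr fun i => ?_
    simp [abs_of_nonneg (weight_nonneg (ρ := ρ) i)]⟩

theorem toLp_apply (f : W ρ) (i : ℤ) : f.toLp i = f.coeff i * weight ρ i := rfl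

theorem norm_toLp (f : W ρ) : ‖f.toLp‖ = ‖f‖ := by
  rw [lp.norm_eq_tsum_rpow (by simp), norm_eq]
  simp [toLp_apply, abs_of_nonneg (weight_nonneg (ρ := ρ) _)]

theorem isometry_toLp [Fact (1 < ρ)] : Isometry (toLp : W ρ → _) := by
  refine Isometry.of_dist_eq fun f g => ?_
  rw [dist_eq_norm, dist_eq_norm, ← norm_toLp (f - g)]
  congr 1
  ext i
  simp [toLp_apply, sub_mul]

theorem surjective_toLp [Fact (1 < ρ)] : Function.Surjective (toLp : W ρ → _) := by
  intro h
  have hw : ∀ i, (weight ρ i : ℂ) ≠ 0 := fun i => by exact_mod_cast (weight_pos i).ne'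
  have hs : Summable fun i : ℤ => ‖h i / weight ρ i‖ * weight ρ i := by
    have := (memℓp_gen_iff (by simp)).1 h.2
    refine this.congr fun i => ?_
    have := (weight_pos (ρ := ρ) i).ne'
    simp [abs_of_nonneg (weight_nonneg (ρ := ρ) i)]
    field_simp
  refine ⟨mk _ hs, ?_⟩
  ext i
  rw [toLp_apply, coeff_mk, div_mul_cancel₀ _ (hw i)]

scoped instance [Fact (1 < ρ)] : CompleteSpace (W ρ) :=
  (isometry_toLp.isUniformInducing.completeSpace_congr surjective_toLp).2 inferInstance

/-! ### Evaluation -/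

/-- The closed annulus `ρ⁻¹ ≤ |lam| ≤ ρ`. -/
def closedAnnulus (ρ : ℝ) : Set ℂ := {lam | ρ⁻¹ ≤ ‖lam‖ ∧ ‖lam‖ ≤ ρ}

theorem mem_closedAnnulus_of_norm_eq_one [hρ : Fact (1 < ρ)] {lam : ℂ} (h : ‖lam‖ = 1) :
    lam ∈ closedAnnulus ρ := by
  rw [closedAnnulus, mem_ofPred_eq, h]
  exact ⟨inv_le_one_of_one_le₀ hρ.out.le, hρ.out.le⟩

theorem ne_zero_of_mem_closedAnnulus [hρ : Fact (1 < ρ)] {lam : ℂ} (h : lam ∈ closedAnnulus ρ) :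
    lam ≠ 0 := by
  rintro rfl
  have h1 := h.1
  rw [norm_zero] at h1
  exact absurd h1 (not_le.2 (inv_pos.2 (zero_lt_one.trans hρ.out)))

/-- The closed annulus is where every monomial is dominated by its weight; convergence and
continuity of evaluation follow. -/
theorem norm_zpow_le_weight [hρ : Fact (1 < ρ)] {lam : ℂ} (h : lam ∈ closedAnnulus ρ) (i : ℤ) :
    ‖lam ^ i‖ ≤ weight ρ i := by
  have h0 : (0 : ℝ) < ρ := zero_lt_one.trans hρ.out
  have hl : 0 < ‖lam‖ := norm_pos_iff.2 (ne_zero_of_mem_closedAnnulus h)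
  rw [weight, abs_of_pos h0, norm_zpow]
  obtain hi | hi := le_total 0 i
  · obtain ⟨n, rfl⟩ := Int.eq_ofNat_of_zero_le hi
    simpa using pow_le_pow_left₀ hl.le h.2 n
  · obtain ⟨n, hn⟩ := Int.eq_ofNat_of_zero_le (neg_nonneg.2 hi)
    obtain rfl : i = -(n : ℤ) := by omega
    simp only [zpow_neg, zpow_natCast, Int.natAbs_neg, Int.natAbs_natCast, ← inv_pow]
    exact pow_le_pow_left₀ (by positivity) (inv_le_of_inv_le₀ h0 h.1) n

theorem norm_coeff_mul_zpow_le [Fact (1 < ρ)] (f : W ρ) {lam : ℂ} (h : lam ∈ closedAnnulus ρ)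
    (i : ℤ) : ‖f.coeff i * lam ^ i‖ ≤ ‖f.coeff i‖ * weight ρ i := by
  rw [norm_mul]
  exact mul_le_mul_of_nonneg_left (norm_zpow_le_weight h i) (norm_nonneg _)

theorem summable_norm_eval [Fact (1 < ρ)] (f : W ρ) {lam : ℂ} (h : lam ∈ closedAnnulus ρ) :
    Summable fun i : ℤ => ‖f.coeff i * lam ^ i‖ :=
  Summable.of_nonneg_of_le (fun _ => norm_nonneg _) (f.norm_coeff_mul_zpow_le h) f.summable_weight

theorem summable_eval [Fact (1 < ρ)] (f : W ρ) {lam : ℂ} (h : lam ∈ closedAnnulus ρ) :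
    Summable fun i : ℤ => f.coeff i * lam ^ i :=
  (f.summable_norm_eval h).of_norm

theorem norm_eval_le [Fact (1 < ρ)] (f : W ρ) {lam : ℂ} (h : lam ∈ closedAnnulus ρ) :
    ‖f.eval lam‖ ≤ ‖f‖ :=
  tsum_of_norm_bounded f.summable_weight.hasSum (f.norm_coeff_mul_zpow_le h)

theorem eval_add [Fact (1 < ρ)] (f g : W ρ) {lam : ℂ} (h : lam ∈ closedAnnulus ρ) :
    (f + g).eval lam = f.eval lam + g.eval lam := by
  rw [eval, eval, eval, ← (f.summable_eval h).tsum_add (g.summable_eval h)]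
  exact tsum_congr fun i => by rw [coeff_add, add_mul]

theorem eval_smul (k : ℂ) (f : W ρ) (lam : ℂ) : (k • f).eval lam = k * f.eval lam := by
  rw [eval, eval, ← tsum_mul_left]
  exact tsum_congr fun i => by rw [coeff_smul, mul_assoc]

/-- Evaluation at a point of the closed annulus as a continuous linear functional. -/
def evalL [Fact (1 < ρ)] {lam : ℂ} (h : lam ∈ closedAnnulus ρ) : W ρ →L[ℂ] ℂ :=
  LinearMap.mkContinuous
    { toFun := fun f => f.eval lam
      map_add' := fun f g => f.eval_add g h
      map_smul' := fun k f => f.eval_smul k lam } 1 fun f => by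
      rw [one_mul]
      exact f.norm_eval_le h

theorem integral_exp_int_mul (n : ℤ) :
    ∫ θ in (0 : ℝ)..2 * Real.pi, Complex.exp (n * θ * Complex.I) =
      (if n = 0 then 2 * Real.pi else 0 : ℂ) := by
  split_ifs with h
  · simp [h]
  · have h1 : (n * Complex.I : ℂ) ≠ 0 := mul_ne_zero (by exact_mod_cast h) Complex.I_ne_zero
    have h2 := integral_exp_mul_complex (a := 0) (b := 2 * Real.pi) h1
    have h3 : Complex.exp (n * Complex.I * (2 * Real.pi : ℝ)) = 1 := by
      rw [Complex.exp_eq_one_iff]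
      exact ⟨n, by push_cast; ring⟩
    rw [h3] at h2
    simp only [Complex.ofReal_zero, mul_zero, Complex.exp_zero, sub_self, zero_div] at h2
    rw [← h2]
    refine intervalIntegral.integral_congr fun θ _ => ?_
    congr 1
    ring

/-- Termwise integration, with the weighted coefficient series as dominating function, reduces this
to orthogonality of the characters. -/
theorem integral_eval_eq [Fact (1 < ρ)] (f : W ρ) (k : ℤ) :
    ∫ θ in (0 : ℝ)..2 * Real.pi,
        f.eval (Complex.exp (θ * Complex.I)) * Complex.exp (-k * θ * Complex.I) =
      2 * Real.pi * f.coeff k := by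
  have hc : ∀ θ : ℝ, Complex.exp (θ * Complex.I) ∈ closedAnnulus ρ := fun θ =>
    mem_closedAnnulus_of_norm_eq_one (Complex.norm_exp_ofReal_mul_I θ)
  have hF : ∀ (i : ℤ) (θ : ℝ), f.coeff i * Complex.exp (θ * Complex.I) ^ i *
      Complex.exp (-k * θ * Complex.I) =
        f.coeff i * Complex.exp (((i - k : ℤ) : ℂ) * θ * Complex.I) := by
    intro i θ
    rw [← Complex.exp_int_mul, mul_assoc, ← Complex.exp_add]
    congr 2
    push_cast
    ring
  have h := intervalIntegral.hasSum_integral_of_dominated_convergence (μ := MeasureTheory.volume)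
    (a := 0) (b := 2 * Real.pi) (ι := ℤ)
    (F := fun i θ => f.coeff i * Complex.exp (θ * Complex.I) ^ i *
      Complex.exp (-k * θ * Complex.I))
    (f := fun θ => f.eval (Complex.exp (θ * Complex.I)) * Complex.exp (-k * θ * Complex.I))
    (fun i _ => ‖f.coeff i‖ * weight ρ i)
    (fun i => by
      refine Continuous.aestronglyMeasurable ?_
      simp_rw [hF]
      fun_prop)
    (fun i => Filter.Eventually.of_forall fun θ _ => by
      rw [norm_mul]
      have h1 : ‖Complex.exp (-k * θ * Complex.I)‖ = 1 := by
        have := Complex.norm_exp_ofReal_mul_I (-k * θ)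
        simpa using this
      rw [h1, mul_one]
      exact f.norm_coeff_mul_zpow_le (hc θ) i)
    (Filter.Eventually.of_forall fun θ _ => f.summable_weight)
    (by simp)
    (Filter.Eventually.of_forall fun θ _ =>
      ((f.summable_eval (hc θ)).hasSum).mul_right _)
  have h2 := h.tsum_eq
  rw [← h2, tsum_eq_single k]
  · simp only [hF, intervalIntegral.integral_const_mul, integral_exp_int_mul]
    simp [mul_comm]
  · intro i hi
    simp only [hF, intervalIntegral.integral_const_mul, integral_exp_int_mul]
    simp [sub_ne_zero.2 hi]

/-- Fourier coefficients are integrals of values on the unit circle. Identities in `𝓦`, including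
the ring axioms below, can therefore be checked pointwise there. -/
theorem ext_eval [Fact (1 < ρ)] {f g : W ρ} (h : ∀ lam : ℂ, ‖lam‖ = 1 → f.eval lam = g.eval lam) :
    f = g := by
  ext k
  have h1 : (2 * Real.pi : ℂ) ≠ 0 := by
    exact_mod_cast (mul_pos two_pos Real.pi_pos).ne'
  refine mul_left_cancel₀ h1 ?_
  rw [← integral_eval_eq, ← integral_eval_eq]
  refine intervalIntegral.integral_congr fun θ _ => ?_
  rw [h _ (Complex.norm_exp_ofReal_mul_I θ)]

/-! ### The Banach algebra structure -/

/-- The shear `(n, k) ↦ (k, n - k)` and submultiplicativity of the weight compare the convolution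
with the product of two summable series. -/
theorem summable_prod_weight [Fact (1 < ρ)] (f g : W ρ) :
    Summable fun p : ℤ × ℤ => ‖f.coeff p.2 * g.coeff (p.1 - p.2)‖ * weight ρ p.1 := by
  have h := f.summable_weight.mul_of_nonneg g.summable_weight
    (fun _ => mul_nonneg (norm_nonneg _) (weight_nonneg _))
    (fun _ => mul_nonneg (norm_nonneg _) (weight_nonneg _))
  let e : ℤ × ℤ ≃ ℤ × ℤ :=
    { toFun := fun p => (p.2, p.1 - p.2)
      invFun := fun p => (p.1 + p.2, p.1)
      left_inv := fun p => by ext <;> simp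
      right_inv := fun p => by ext <;> simp }
  refine Summable.of_nonneg_of_le (fun p => mul_nonneg (norm_nonneg _) (weight_nonneg _))
    (fun p => ?_) ((e.summable_iff).2 h)
  have h1 := weight_add_le (ρ := ρ) p.2 (p.1 - p.2)
  rw [add_sub_cancel] at h1
  calc _ ≤ ‖f.coeff p.2 * g.coeff (p.1 - p.2)‖ * (weight ρ p.2 * weight ρ (p.1 - p.2)) :=
        mul_le_mul_of_nonneg_left h1 (norm_nonneg _)
    _ = _ := by simp only [norm_mul, Function.comp, e, Equiv.coe_fn_mk]; ring

theorem summable_conv [Fact (1 < ρ)] (f g : W ρ) (n : ℤ) :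
    Summable fun k : ℤ => ‖f.coeff k * g.coeff (n - k)‖ := by
  have h := (summable_prod_weight f g).prod_factor n
  refine Summable.of_nonneg_of_le (fun _ => norm_nonneg _) (fun k => ?_) h
  exact le_mul_of_one_le_right (norm_nonneg _) (one_le_weight _)

theorem norm_conv_mul_weight_le [Fact (1 < ρ)] (f g : W ρ) (n : ℤ) :
    ‖∑' k : ℤ, f.coeff k * g.coeff (n - k)‖ * weight ρ n ≤
      ∑' k : ℤ, ‖f.coeff k * g.coeff (n - k)‖ * weight ρ n := by
  rw [tsum_mul_right]
  exact mul_le_mul_of_nonneg_right (norm_tsum_le_tsum_norm (summable_conv f g n)) (weight_nonneg _)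

scoped instance [Fact (1 < ρ)] : Mul (W ρ) :=
  ⟨fun f g => mk (fun n => ∑' k : ℤ, f.coeff k * g.coeff (n - k))
    (Summable.of_nonneg_of_le (fun _ => mul_nonneg (norm_nonneg _) (weight_nonneg _))
      (norm_conv_mul_weight_le f g) (summable_prod_weight f g).prod)⟩

theorem coeff_mul [Fact (1 < ρ)] (f g : W ρ) (n : ℤ) :
    (f * g).coeff n = ∑' k : ℤ, f.coeff k * g.coeff (n - k) := rfl

theorem norm_mul_le' [Fact (1 < ρ)] (f g : W ρ) : ‖f * g‖ ≤ ‖f‖ * ‖g‖ := by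
  have hs := (summable_prod_weight f g)
  have h := f.summable_weight.mul_of_nonneg g.summable_weight
    (fun _ => mul_nonneg (norm_nonneg _) (weight_nonneg _))
    (fun _ => mul_nonneg (norm_nonneg _) (weight_nonneg _))
  let e : ℤ × ℤ ≃ ℤ × ℤ :=
    { toFun := fun p => (p.2, p.1 - p.2)
      invFun := fun p => (p.1 + p.2, p.1)
      left_inv := fun p => by ext <;> simp
      right_inv := fun p => by ext <;> simp }
  calc ‖f * g‖ ≤ ∑' n : ℤ, ∑' k : ℤ, ‖f.coeff k * g.coeff (n - k)‖ * weight ρ n :=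
        (f * g).summable_weight.tsum_le_tsum (norm_conv_mul_weight_le f g) hs.prod
    _ = ∑' p : ℤ × ℤ, ‖f.coeff p.2 * g.coeff (p.1 - p.2)‖ * weight ρ p.1 := hs.tsum_prod.symm
    _ ≤ ∑' p : ℤ × ℤ, (‖f.coeff (e p).1‖ * weight ρ (e p).1) *
          (‖g.coeff (e p).2‖ * weight ρ (e p).2) := by
        refine hs.tsum_le_tsum (fun p => ?_) ((e.summable_iff).2 h)
        have h1 := weight_add_le (ρ := ρ) p.2 (p.1 - p.2)
        rw [add_sub_cancel] at h1
        calc _ ≤ ‖f.coeff p.2 * g.coeff (p.1 - p.2)‖ * (weight ρ p.2 * weight ρ (p.1 - p.2)) :=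
              mul_le_mul_of_nonneg_left h1 (norm_nonneg _)
          _ = _ := by simp only [norm_mul, e, Equiv.coe_fn_mk]; ring
    _ = ∑' p : ℤ × ℤ, (‖f.coeff p.1‖ * weight ρ p.1) * (‖g.coeff p.2‖ * weight ρ p.2) :=
        e.tsum_eq fun p : ℤ × ℤ => (‖f.coeff p.1‖ * weight ρ p.1) * (‖g.coeff p.2‖ * weight ρ p.2)
    _ = ‖f‖ * ‖g‖ := by
        rw [norm_eq f, norm_eq g, f.summable_weight.tsum_mul_tsum g.summable_weight h]

theorem eval_mul [Fact (1 < ρ)] (f g : W ρ) {lam : ℂ} (hl : lam ∈ closedAnnulus ρ) :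
    (f * g).eval lam = f.eval lam * g.eval lam := by
  have hne := ne_zero_of_mem_closedAnnulus hl
  have hs := summable_mul_of_summable_norm (f.summable_norm_eval hl) (g.summable_norm_eval hl)
  let e : ℤ × ℤ ≃ ℤ × ℤ :=
    { toFun := fun p => (p.2, p.1 - p.2)
      invFun := fun p => (p.1 + p.2, p.1)
      left_inv := fun p => by ext <;> simp
      right_inv := fun p => by ext <;> simp }
  have key : ∀ p : ℤ × ℤ, f.coeff (e p).1 * lam ^ (e p).1 * (g.coeff (e p).2 * lam ^ (e p).2) =
      f.coeff p.2 * g.coeff (p.1 - p.2) * lam ^ p.1 := by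
    intro p
    have : lam ^ p.1 = lam ^ p.2 * lam ^ (p.1 - p.2) := by
      rw [← zpow_add₀ hne, add_sub_cancel]
    rw [this]
    simp only [e, Equiv.coe_fn_mk]
    ring
  rw [eval, eval, eval, tsum_mul_tsum_of_summable_norm (f.summable_norm_eval hl)
    (g.summable_norm_eval hl), ← e.tsum_eq]
  have hs' := (e.summable_iff).2 hs
  simp only [Function.comp_def, key] at hs' ⊢
  rw [hs'.tsum_prod]
  exact tsum_congr fun n => by simp only [coeff_mul, tsum_mul_right]

/-- The function `lam ^ m`. -/
def mono (m : ℤ) : W ρ :=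
  mk (fun i => if i = m then 1 else 0) (by
    refine summable_of_ne_finset_zero (s := {m}) fun i hi => ?_
    rw [Finset.mem_singleton] at hi
    simp [hi])

theorem coeff_mono (m i : ℤ) : (mono m : W ρ).coeff i = if i = m then 1 else 0 := rfl

theorem eval_mono (m : ℤ) (lam : ℂ) : (mono m : W ρ).eval lam = lam ^ m := by
  rw [eval, tsum_eq_single m (fun i hi => by simp [coeff_mono, hi])]
  simp [coeff_mono]

theorem norm_mono (m : ℤ) : ‖(mono m : W ρ)‖ = weight ρ m := by
  rw [norm_eq, tsum_eq_single m (fun i hi => by simp [coeff_mono, hi])]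
  simp [coeff_mono]

scoped instance : One (W ρ) := ⟨mono 0⟩

theorem one_eq_mono : (1 : W ρ) = mono 0 := rfl

theorem eval_one (lam : ℂ) : (1 : W ρ).eval lam = 1 := by
  rw [one_eq_mono, eval_mono, zpow_zero]

scoped instance [Fact (1 < ρ)] : CommRing (W ρ) :=
  { (inferInstance : AddCommGroup (W ρ)) with
    mul := (· * ·)
    one := 1
    mul_assoc := fun f g h => ext_eval fun lam hl => by
      have hl' := mem_closedAnnulus_of_norm_eq_one (ρ := ρ) hl
      simp only [eval_mul _ _ hl', mul_assoc]
    mul_comm := fun f g => ext_eval fun lam hl => by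
      have hl' := mem_closedAnnulus_of_norm_eq_one (ρ := ρ) hl
      rw [eval_mul _ _ hl', eval_mul _ _ hl', mul_comm]
    one_mul := fun f => ext_eval fun lam hl => by
      rw [eval_mul _ _ (mem_closedAnnulus_of_norm_eq_one hl), eval_one, one_mul]
    mul_one := fun f => ext_eval fun lam hl => by
      rw [eval_mul _ _ (mem_closedAnnulus_of_norm_eq_one hl), eval_one, mul_one]
    zero_mul := fun f => by ext n; simp [coeff_mul]
    mul_zero := fun f => by ext n; simp [coeff_mul]
    left_distrib := fun f g h => ext_eval fun lam hl => by
      have hl' := mem_closedAnnulus_of_norm_eq_one (ρ := ρ) hl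
      simp only [eval_mul _ _ hl', eval_add _ _ hl', mul_add]
    right_distrib := fun f g h => ext_eval fun lam hl => by
      have hl' := mem_closedAnnulus_of_norm_eq_one (ρ := ρ) hl
      simp only [eval_mul _ _ hl', eval_add _ _ hl', add_mul] }

scoped instance [Fact (1 < ρ)] : NormedCommRing (W ρ) :=
  { (inferInstance : NormedAddCommGroup (W ρ)), (inferInstance : CommRing (W ρ)) with
    norm_mul_le := norm_mul_le' }

scoped instance [Fact (1 < ρ)] : Algebra ℂ (W ρ) :=
  Algebra.ofModule
    (fun k f g => by ext n; simp [coeff_mul, mul_assoc, tsum_mul_left])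
    (fun k f g => by ext n; simp [coeff_mul, mul_left_comm, tsum_mul_left])

scoped instance [Fact (1 < ρ)] : NormedAlgebra ℂ (W ρ) :=
  { (inferInstance : Algebra ℂ (W ρ)) with
    norm_smul_le := fun k f => norm_smul_le k f }

scoped instance [Fact (1 < ρ)] : NormOneClass (W ρ) :=
  ⟨by rw [one_eq_mono, norm_mono, weight_zero]⟩

/-- Evaluation at a point of the closed annulus as a ring homomorphism. -/
def evalHom [Fact (1 < ρ)] {lam : ℂ} (h : lam ∈ closedAnnulus ρ) : W ρ →+* ℂ where
  toFun f := f.eval lam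
  map_one' := eval_one lam
  map_mul' f g := f.eval_mul g h
  map_zero' := (evalL h).map_zero
  map_add' f g := f.eval_add g h

@[simp]
theorem evalHom_apply [Fact (1 < ρ)] {lam : ℂ} (h : lam ∈ closedAnnulus ρ) (f : W ρ) :
    evalHom h f = f.eval lam := rfl

theorem coeff_mono_mul [Fact (1 < ρ)] (m : ℤ) (f : W ρ) (n : ℤ) :
    (mono m * f).coeff n = f.coeff (n - m) := by
  rw [coeff_mul, tsum_eq_single m (fun i hi => by simp [coeff_mono, hi])]
  simp [coeff_mono]

theorem mono_mul_mono [Fact (1 < ρ)] (m n : ℤ) : (mono m * mono n : W ρ) = mono (m + n) := by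
  ext i
  rw [coeff_mono_mul, coeff_mono, coeff_mono]
  congr 1
  exact propext ⟨fun h => by omega, fun h => by omega⟩

/-! ### Conjugation on the unit circle -/

scoped instance : Star (W ρ) :=
  ⟨fun f => mk (fun i => star (f.coeff (-i))) (by
    refine ((Equiv.neg ℤ).summable_iff.2 f.summable_weight).congr fun i => ?_
    simp [weight_neg])⟩

theorem coeff_star (f : W ρ) (i : ℤ) : (star f).coeff i = star (f.coeff (-i)) := rfl

theorem norm_star' (f : W ρ) : ‖star f‖ = ‖f‖ := by
  rw [norm_eq, norm_eq, ← (Equiv.neg ℤ).tsum_eq fun i => ‖f.coeff i‖ * weight ρ i]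
  simp [coeff_star, weight_neg]

/-- On the unit circle `conj λ = λ⁻¹`, so conjugating the function conjugates the coefficients and
reverses their order. -/
theorem eval_star (f : W ρ) {lam : ℂ} (h : ‖lam‖ = 1) : (star f).eval lam = star (f.eval lam) := by
  have h0 : (starRingEnd ℂ) lam = lam⁻¹ := (Complex.inv_eq_conj h).symm
  rw [eval, eval, ← starRingEnd_apply, Complex.conj_tsum,
    ← (Equiv.neg ℤ).tsum_eq fun i => (star f).coeff i * lam ^ i]
  refine tsum_congr fun i => ?_
  rw [Equiv.neg_apply, coeff_star, neg_neg, map_mul, map_zpow₀, h0, inv_zpow, zpow_neg]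
  rfl

scoped instance [Fact (1 < ρ)] : StarRing (W ρ) where
  star_involutive f := by ext i; simp [coeff_star]
  star_mul f g := ext_eval fun lam h => by
    have h' := mem_closedAnnulus_of_norm_eq_one (ρ := ρ) h
    rw [eval_star _ h, eval_mul _ _ h', eval_mul _ _ h', eval_star _ h, eval_star _ h, star_mul]
  star_add f g := by ext i; simp [coeff_star]

scoped instance [Fact (1 < ρ)] : ContinuousStar (W ρ) :=
  ⟨(AddMonoidHomClass.isometry_of_norm (starAddEquiv : W ρ ≃+ W ρ) norm_star').continuous⟩

/-! ### The derivative at `lam = 1` -/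

/-- The open annulus. -/
def openAnnulus (ρ : ℝ) : Set ℂ := {lam | ρ⁻¹ < ‖lam‖ ∧ ‖lam‖ < ρ}

theorem isOpen_openAnnulus : IsOpen (openAnnulus ρ) :=
  (isOpen_lt continuous_const continuous_norm).inter (isOpen_lt continuous_norm continuous_const)

theorem one_mem_openAnnulus [hρ : Fact (1 < ρ)] : (1 : ℂ) ∈ openAnnulus ρ := by
  simp only [openAnnulus, mem_ofPred_eq, norm_one]
  exact ⟨inv_lt_one_of_one_lt₀ hρ.out, hρ.out⟩

theorem openAnnulus_subset : openAnnulus ρ ⊆ closedAnnulus ρ := fun _ h => ⟨h.1.le, h.2.le⟩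

theorem differentiableOn_eval [Fact (1 < ρ)] (f : W ρ) :
    DifferentiableOn ℂ f.eval (openAnnulus ρ) := by
  refine Complex.differentiableOn_tsum_of_summable_norm f.summable_weight (fun i => ?_)
    isOpen_openAnnulus fun i lam h => f.norm_coeff_mul_zpow_le (openAnnulus_subset h) i
  intro lam h
  exact (((differentiableAt_zpow.2
    (Or.inl (ne_zero_of_mem_closedAnnulus (openAnnulus_subset h)))).const_mul _)
      ).differentiableWithinAt

theorem differentiableAt_eval_one [Fact (1 < ρ)] (f : W ρ) : DifferentiableAt ℂ f.eval 1 :=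
  f.differentiableOn_eval.differentiableAt (isOpen_openAnnulus.mem_nhds one_mem_openAnnulus)

/-- Cauchy's estimate on a small circle around `1` inside the open annulus; since `ρ > 1`, the
derivative at `1` is a continuous functional on `𝓦`. -/
theorem exists_norm_deriv_eval_one_le [Fact (1 < ρ)] :
    ∃ C : ℝ, ∀ f : W ρ, ‖deriv f.eval 1‖ ≤ C * ‖f‖ := by
  obtain ⟨r, hr, hsub⟩ := Metric.nhds_basis_closedBall.mem_iff.1
    (isOpen_openAnnulus.mem_nhds (one_mem_openAnnulus (ρ := ρ)))
  refine ⟨r⁻¹, fun f => ?_⟩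
  have h := Complex.norm_deriv_le_of_forall_mem_sphere_norm_le (f := f.eval) (c := 1) (C := ‖f‖) hr
    ((f.differentiableOn_eval.mono hsub).diffContOnCl_ball subset_rfl) fun z hz =>
      f.norm_eval_le (openAnnulus_subset (hsub (Metric.sphere_subset_closedBall hz)))
  rwa [inv_mul_eq_div]

theorem eventuallyEq_eval_add [Fact (1 < ρ)] (f g : W ρ) :
    (f + g).eval =ᶠ[nhds 1] f.eval + g.eval :=
  Filter.eventually_of_mem (isOpen_openAnnulus.mem_nhds one_mem_openAnnulus) fun _ h =>
    eval_add f g (openAnnulus_subset h)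

/-- The derivative in `lam` at `lam = 1` as a continuous linear functional. -/
def derivOne [Fact (1 < ρ)] : W ρ →L[ℂ] ℂ :=
  LinearMap.mkContinuousOfExistsBound
    { toFun := fun f => deriv f.eval 1
      map_add' := fun f g => by
        rw [(eventuallyEq_eval_add f g).deriv_eq,
          deriv_add f.differentiableAt_eval_one g.differentiableAt_eval_one]
      map_smul' := fun k f => by
        have : (k • f).eval = fun lam => k * f.eval lam := funext fun lam => eval_smul k f lam
        rw [this, deriv_const_mul _ f.differentiableAt_eval_one]
        rfl }
    exists_norm_deriv_eval_one_le

theorem hasDerivAt_eval_one [Fact (1 < ρ)] (f : W ρ) : HasDerivAt f.eval (derivOne f) 1 :=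
  f.differentiableAt_eval_one.hasDerivAt

/-! ### Projections onto sets of degrees and Hankel operators -/

open Classical in
/-- The projection onto the functions with Fourier coefficients supported in `s`. -/
def restrict [Fact (1 < ρ)] (s : Set ℤ) : W ρ →L[ℂ] W ρ :=
  LinearMap.mkContinuous
    { toFun := fun f => mk (fun i => if i ∈ s then f.coeff i else 0)
        (Summable.of_nonneg_of_le (fun _ => mul_nonneg (norm_nonneg _) (weight_nonneg _))
          (fun i => by
            refine mul_le_mul_of_nonneg_right ?_ (weight_nonneg i)
            split_ifs
            · exact le_rfl
            · simp) f.summable_weight)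
      map_add' := fun f g => by
        ext i
        simp only [coeff_mk, coeff_add]
        split_ifs <;> simp
      map_smul' := fun k f => by
        ext i
        simp only [coeff_mk, coeff_smul, RingHom.id_apply]
        split_ifs <;> simp } 1 fun f => by
      rw [one_mul]
      refine Summable.tsum_le_tsum (fun i => ?_) (summable_weight _) f.summable_weight
      refine mul_le_mul_of_nonneg_right ?_ (weight_nonneg i)
      simp only [LinearMap.coe_mk, AddHom.coe_mk, coeff_mk]
      split_ifs
      · exact le_rfl
      · simp

open Classical in
theorem coeff_restrict [Fact (1 < ρ)] (s : Set ℤ) (f : W ρ) (i : ℤ) :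
    (restrict s f).coeff i = if i ∈ s then f.coeff i else 0 := rfl

theorem restrict_eq_self [Fact (1 < ρ)] {s : Set ℤ} {f : W ρ} (h : ∀ i ∉ s, f.coeff i = 0) :
    restrict s f = f := by
  ext i
  rw [coeff_restrict]
  split_ifs with hi
  · rfl
  · exact (h i hi).symm

/-- Laurent polynomials are dense: the expansion converges absolutely because the norm of a monomial
is exactly its weight, and coefficients identify the sum. -/
theorem hasSum_mono [Fact (1 < ρ)] (f : W ρ) : HasSum (fun m => f.coeff m • mono m) f := by
  have hs : Summable fun m => f.coeff m • (mono m : W ρ) := by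
    refine Summable.of_norm (f.summable_weight.congr fun m => ?_)
    rw [norm_smul, norm_mono]
  obtain ⟨g, hg⟩ := hs
  convert hg
  ext i
  have h1 := (coeffL i).hasSum hg
  have h2 := hasSum_ite_eq i (f.coeff i)
  refine h2.unique (h1.congr_fun ?_)
  intro m
  simp only [coeffL_apply, coeff_smul, coeff_mono]
  by_cases h : m = i
  · simp [h]
  · simp [h, Ne.symm h]

/-- The Hankel operator with symbol `u` from degrees `≤ 1` to degrees `≥ 2`, depending linearly
on `u`. -/
def hankel [Fact (1 < ρ)] : W ρ →L[ℂ] W ρ →L[ℂ] W ρ :=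
  (ContinuousLinearMap.compL ℂ (W ρ) (W ρ) (W ρ) (restrict (Ici 2))) ∘L
    ((ContinuousLinearMap.compL ℂ (W ρ) (W ρ) (W ρ)).flip (restrict (Iic 1))) ∘L
      ContinuousLinearMap.mul ℂ (W ρ)

theorem hankel_apply [Fact (1 < ρ)] (u g : W ρ) :
    hankel u g = restrict (Ici 2) (u * restrict (Iic 1) g) := rfl

/-- Multiplication by `λ ^ m` sends degrees at most `1` to degrees at most `m + 1`, of which only
`2, …, m + 1` survive. The operator thus has finite rank, and is zero for `m ≤ 0`. -/
theorem hankel_mono [Fact (1 < ρ)] (m : ℤ) :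
    hankel (mono m : W ρ) =
      ∑ n ∈ Finset.Icc 2 (m + 1), (coeffL (n - m)).smulRight (mono n : W ρ) := by
  ext1 g
  ext i
  rw [hankel_apply, coeff_restrict, coeff_mono_mul, coeff_restrict, sum_apply,
    ← coeffL_apply i (∑ n ∈ _, _), map_sum]
  simp only [ContinuousLinearMap.smulRight_apply, coeffL_apply, coeff_smul, coeff_mono,
    mem_Ici, mem_Iic, mul_ite, mul_one, mul_zero, Finset.sum_ite_eq, Finset.mem_Icc]
  split_ifs <;> first | rfl | omega

theorem isCompactOperator_smulRight_mono [Fact (1 < ρ)] (m n : ℤ) :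
    IsCompactOperator ((coeffL m).smulRight (mono n : W ρ) : W ρ →L[ℂ] W ρ) := by
  have h : IsCompactOperator (coeffL m : W ρ →L[ℂ] ℂ) :=
    isCompactOperator_of_locallyCompactSpace_dom _
  exact h.clm_comp (ContinuousLinearMap.toSpanSingleton ℂ (mono n : W ρ))

/-- Compactness passes from monomial symbols to all symbols, since `hankel` is continuous in the
symbol and norm limits of compact operators are compact. -/
theorem isCompactOperator_hankel [Fact (1 < ρ)] (u : W ρ) : IsCompactOperator (hankel u) := by
  have h1 : ∀ m : ℤ, IsCompactOperator (hankel (mono m : W ρ)) := by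
    intro m
    rw [hankel_mono]
    refine Finset.sum_induction (fun n => (coeffL (n - m)).smulRight (mono n : W ρ))
      (fun T : W ρ →L[ℂ] W ρ => IsCompactOperator T) (fun _ _ => IsCompactOperator.add)
      isCompactOperator_zero fun n _ => ?_
    exact isCompactOperator_smulRight_mono (n - m) n
  have h2 := (hankel (ρ := ρ)).hasSum u.hasSum_mono
  refine isCompactOperator_of_tendsto h2 (Filter.Eventually.of_forall fun s => ?_)
  refine Finset.sum_induction (fun m => hankel (u.coeff m • (mono m : W ρ)))
      (fun T : W ρ →L[ℂ] W ρ => IsCompactOperator T) (fun _ _ => IsCompactOperator.add)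
      isCompactOperator_zero fun m _ => ?_
  rw [map_smul]
  exact (h1 m).smul (u.coeff m)

theorem isCompactOperator_restrict_Icc [Fact (1 < ρ)] (m n : ℤ) :
    IsCompactOperator (restrict (Icc m n) : W ρ →L[ℂ] W ρ) := by
  have h : (restrict (Icc m n) : W ρ →L[ℂ] W ρ) =
      ∑ k ∈ Finset.Icc m n, (coeffL k).smulRight (mono k : W ρ) := by
    ext1 g
    ext i
    rw [coeff_restrict, sum_apply, ← coeffL_apply i (∑ k ∈ _, _), map_sum]
    simp only [ContinuousLinearMap.smulRight_apply, coeffL_apply, coeff_smul, coeff_mono,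
      mem_Icc, mul_ite, mul_one, mul_zero, Finset.sum_ite_eq, Finset.mem_Icc]
  rw [h]
  exact Finset.sum_induction (fun k => (coeffL k).smulRight (mono k : W ρ))
    (fun T : W ρ →L[ℂ] W ρ => IsCompactOperator T) (fun _ _ => IsCompactOperator.add)
    isCompactOperator_zero fun k _ => isCompactOperator_smulRight_mono k k

/-- Working along one ultrafilter yields limits for several compact operators at once, with no
successive subsequences. -/
theorem exists_tendsto_of_isCompactOperator [Fact (1 < ρ)] {ι : Type*} (l : Ultrafilter ι)
    {T : W ρ →L[ℂ] W ρ} (hT : IsCompactOperator T) (g : ι → W ρ) {C : ℝ} (hg : ∀ i, ‖g i‖ ≤ C) :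
    ∃ y, Filter.Tendsto (fun i => T (g i)) l (nhds y) := by
  obtain ⟨K, hK, hsub⟩ := hT.image_closedBall_subset_compact (f := (T : W ρ →ₗ[ℂ] W ρ)) C
  obtain ⟨y, -, hy⟩ := hK.ultrafilter_le_nhds (l.map fun i => T (g i))
    (Filter.le_principal_iff.2 (Filter.mem_map.2 (Filter.Eventually.of_forall fun i =>
      hsub ⟨g i, by simpa using hg i, rfl⟩)))
  exact ⟨y, hy⟩

end W

open scoped W

/-! ### Bounds on polar and regular parts from values on a circle. -/

section MaximumPrinciple

variable {E : Type*} [NormedAddCommGroup E] [NormedSpace ℂ E]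

theorem norm_le_of_forall_mem_sphere {f : ℂ → E} {r R κ : ℝ} (hr : 0 < r) (hrR : r < R)
    (hf : DifferentiableOn ℂ f (Metric.ball 0 R)) (hκ : ∀ z, ‖z‖ = r → ‖f z‖ ≤ κ) {z : ℂ}
    (hz : ‖z‖ ≤ r) : ‖f z‖ ≤ κ := by
  refine Complex.norm_le_of_forall_mem_frontier_norm_le (U := Metric.ball 0 r)
    Metric.isBounded_ball (hf.diffContOnCl_ball (Metric.closedBall_subset_ball hrR))
    (fun w hw => hκ w ?_) ?_
  · rw [frontier_ball _ hr.ne'] at hw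
    simpa using hw
  · rw [closure_ball _ hr.ne']
    simpa using hz

/-- Cauchy estimates for a holomorphic function with a pole of order at most three. -/
theorem norm_principalPart_le {f h : ℂ → E} {a b c : E} {r R κ : ℝ} (hr : 0 < r) (hrR : r < R)
    (hh : DifferentiableOn ℂ h (Metric.ball 0 R))
    (hf : ∀ z : ℂ, ‖z‖ = r → f z = (z ^ 3)⁻¹ • a + (z ^ 2)⁻¹ • b + z⁻¹ • c + h z)
    (hκ : ∀ z, ‖z‖ = r → ‖f z‖ ≤ κ) :
    ‖a‖ ≤ r ^ 3 * κ ∧ ‖b‖ ≤ 2 * r ^ 2 * κ ∧ ‖c‖ ≤ 4 * r * κ ∧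
      ∀ z : ℂ, ‖z‖ ≤ r → ‖h z‖ ≤ 8 * κ := by
  have hne : ∀ z : ℂ, ‖z‖ = r → z ≠ 0 := by
    rintro z hz rfl
    rw [norm_zero] at hz
    exact hr.ne hz
  have h0 : ‖(0 : ℂ)‖ ≤ r := by simpa using hr.le
  -- The value at the centre bounds `x`; subtracting `x` and dividing by `z` bounds `g` on the
  -- circle. Three applications to `z³ f = a + z (b + z (c + z h))` peel off the coefficients and
  -- produce the factors `1, 2, 4, 8`.
  have step : ∀ {x : E} {g : ℂ → E} {B : ℝ}, DifferentiableOn ℂ g (Metric.ball 0 R) →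
      (∀ z : ℂ, ‖z‖ = r → ‖x + z • g z‖ ≤ B) →
      ‖x‖ ≤ B ∧ ∀ z : ℂ, ‖z‖ = r → ‖g z‖ ≤ 2 * B / r := by
    intro x g B hg hB
    have hx : ‖x‖ ≤ B := by
      have := norm_le_of_forall_mem_sphere (f := fun z => x + z • g z) hr hrR
        ((differentiableOn_const x).add (differentiableOn_id.smul hg)) hB h0
      simpa using this
    refine ⟨hx, fun z hz => ?_⟩
    have h1 : ‖z • g z‖ ≤ 2 * B := by
      have h2 := norm_sub_le (x + z • g z) x
      rw [add_sub_cancel_left] at h2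
      linarith [hB z hz]
    rw [norm_smul, hz] at h1
    rw [le_div_iff₀ hr, mul_comm]
    exact h1
  have hd1 : DifferentiableOn ℂ (fun z => c + z • h z) (Metric.ball 0 R) :=
    (differentiableOn_const c).add (differentiableOn_id.smul hh)
  have hd2 : DifferentiableOn ℂ (fun z => b + z • (c + z • h z)) (Metric.ball 0 R) :=
    (differentiableOn_const b).add (differentiableOn_id.smul hd1)
  obtain ⟨ha, h1⟩ := step (x := a) (B := r ^ 3 * κ) hd2 fun z hz => by
    have : a + z • (b + z • (c + z • h z)) = z ^ 3 • f z := by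
      have hz0 := hne z hz
      rw [hf z hz]
      match_scalars <;> field_simp
    rw [this, norm_smul, norm_pow, hz]
    exact mul_le_mul_of_nonneg_left (hκ z hz) (by positivity)
  obtain ⟨hb, h2⟩ := step hd1 h1
  obtain ⟨hc, h3⟩ := step hh h2
  have e1 : 2 * (r ^ 3 * κ) / r = 2 * r ^ 2 * κ := by field_simp
  have e2 : 2 * (2 * r ^ 2 * κ) / r = 4 * r * κ := by field_simp; ring
  have e3 : 2 * (4 * r * κ) / r = 8 * κ := by field_simp; ring
  rw [e1] at hb h2 h3 hc
  rw [e2] at hc h3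
  rw [e3] at h3
  exact ⟨ha, hb, hc, fun z hz => norm_le_of_forall_mem_sphere hr hrR hh h3 hz⟩

end MaximumPrinciple

/-! ### First-order expansion of the monodromy in a Banach algebra. -/

section BanachAlgebra

variable {𝔸 : Type*} [NormedRing 𝔸] [NormedAlgebra ℂ 𝔸]

/-- A linear differential equation with small holomorphic coefficient on a disk has a
holomorphic solution close to `1`. -/
theorem exists_hasDerivAt_mul_of_norm_le [NormOneClass 𝔸] [CompleteSpace 𝔸] {E : ℂ → 𝔸} {r e : ℝ}
    (hr : 0 < r)
    (hE : DifferentiableOn ℂ E (Metric.ball 0 r)) (he : ∀ z ∈ Metric.ball (0 : ℂ) r, ‖E z‖ ≤ e)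
    (her : e * r ≤ 1 / 2) :
    ∃ V : ℂ → 𝔸, ∀ z ∈ Metric.ball (0 : ℂ) r,
      HasDerivAt V (E z * V z) z ∧ ‖V z - 1‖ ≤ 2 * (e * r) := by
  have h0 : (0 : ℂ) ∈ Metric.ball (0 : ℂ) r := Metric.mem_ball_self hr
  have he0 : 0 ≤ e := (norm_nonneg _).trans (he 0 h0)
  -- Picard iteration: each term is the primitive, vanishing at `0`, of `E` times the preceding one.
  -- Holomorphy of `f` is placed inside the existential so that `choose` yields a total operation.
  have hstep : ∀ f : ℂ → 𝔸, ∃ g : ℂ → 𝔸, DifferentiableOn ℂ f (Metric.ball 0 r) →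
      g 0 = 0 ∧ ∀ z ∈ Metric.ball (0 : ℂ) r, HasDerivAt g (E z * f z) z := by
    intro f
    by_cases hf : DifferentiableOn ℂ f (Metric.ball 0 r)
    · obtain ⟨g, hg⟩ := (hE.mul hf).isExactOn_ball.with_val_at 0 0
      exact ⟨g, fun _ => hg⟩
    · exact ⟨f, fun h => absurd h hf⟩
  choose step hstep using hstep
  let V : ℕ → ℂ → 𝔸 := fun n => Nat.rec (fun _ => 1) (fun _ f => step f) n
  have hVs : ∀ n, V (n + 1) = step (V n) := fun _ => rfl
  have hVd : ∀ n, DifferentiableOn ℂ (V n) (Metric.ball 0 r) := by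
    intro n
    induction n with
    | zero => exact differentiableOn_const 1
    | succ n ih =>
      intro z hz
      rw [hVs]
      exact ((hstep _ ih).2 z hz).differentiableAt.differentiableWithinAt
  have hV0 : ∀ n, V (n + 1) 0 = 0 := fun n => (hstep _ (hVd n)).1
  have hV' : ∀ n, ∀ z ∈ Metric.ball (0 : ℂ) r, HasDerivAt (V (n + 1)) (E z * V n z) z :=
    fun n => (hstep _ (hVd n)).2
  have hVn : ∀ n, ∀ z ∈ Metric.ball (0 : ℂ) r, ‖V n z‖ ≤ (e * r) ^ n := by
    intro n
    induction n with
    | zero => intro z _; simp [V]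
    | succ n ih =>
      intro z hz
      have h1 := (convex_ball (0 : ℂ) r).norm_image_sub_le_of_norm_hasDerivWithin_le
        (f := V (n + 1)) (f' := fun z => E z * V n z) (C := e * (e * r) ^ n)
        (fun z hz => (hV' n z hz).hasDerivWithinAt)
        (fun z hz => (norm_mul_le _ _).trans (mul_le_mul (he z hz) (ih z hz) (norm_nonneg _) he0))
        h0 hz
      rw [hV0, sub_zero, sub_zero] at h1
      refine h1.trans ?_
      have h2 : ‖z‖ ≤ r := by simpa using (Metric.mem_ball.1 hz).le
      calc e * (e * r) ^ n * ‖z‖ ≤ e * (e * r) ^ n * r :=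
            mul_le_mul_of_nonneg_left h2 (by positivity)
        _ = (e * r) ^ (n + 1) := by ring
  have hq0 : 0 ≤ e * r := by positivity
  have hq1 : e * r < 1 := by linarith
  have hgeo := summable_geometric_of_lt_one hq0 hq1
  have hsum : ∀ z ∈ Metric.ball (0 : ℂ) r, Summable fun n => V n z := fun z hz =>
    Summable.of_norm_bounded hgeo fun n => hVn n z hz
  refine ⟨fun z => 1 + ∑' n, V (n + 1) z, fun z hz => ⟨?_, ?_⟩⟩
  · have h1 := hasDerivAt_tsum_of_isPreconnected (g := fun n => V (n + 1))
      (g' := fun n z => E z * V n z) (u := fun n => e * (e * r) ^ n) (y₀ := 0) (y := z)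
      (hgeo.mul_left e) Metric.isOpen_ball (convex_ball (0 : ℂ) r).isPreconnected hV'
      (fun n z hz => (norm_mul_le _ _).trans
        (mul_le_mul (he z hz) (hVn n z hz) (norm_nonneg _) he0)) h0
      (by simp only [hV0]; exact summable_zero) hz
    have h2 := h1.const_add 1
    rw [(hsum z hz).tsum_mul_left, (hsum z hz).tsum_eq_zero_add] at h2
    exact h2
  · rw [add_sub_cancel_left]
    refine (tsum_of_norm_bounded ((hasSum_geometric_of_lt_one hq0 hq1).mul_left (e * r))
      fun n => ?_).trans ?_
    · have := hVn (n + 1) z hz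
      rwa [pow_succ'] at this
    · rw [mul_comm 2]
      refine mul_le_mul_of_nonneg_left ?_ hq0
      exact inv_le_of_inv_le₀ two_pos (by linarith)

theorem one_add_smul_mul_one_sub_smul {N : 𝔸} (hN : N * N = 0) (z : ℂ) :
    (1 + z • N) * (1 - z • N) = 1 := by
  simp [mul_sub, add_mul, hN]

theorem one_sub_smul_mul_one_add_smul {N : 𝔸} (hN : N * N = 0) (z : ℂ) :
    (1 - z • N) * (1 + z • N) = 1 := by
  simp [mul_add, sub_mul, hN]

theorem norm_one_add_smul_le [NormOneClass 𝔸] (N : 𝔸) {z : ℂ} {r : ℝ} (hz : ‖z‖ ≤ r) :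
    ‖1 + z • N‖ ≤ 1 + r * ‖N‖ := by
  refine (norm_add_le _ _).trans ?_
  rw [norm_one, norm_smul]
  gcongr

theorem norm_one_sub_smul_le [NormOneClass 𝔸] (N : 𝔸) {z : ℂ} {r : ℝ} (hz : ‖z‖ ≤ r) :
    ‖1 - z • N‖ ≤ 1 + r * ‖N‖ := by
  simpa [sub_eq_add_neg] using norm_one_add_smul_le N (z := -z) (by simpa using hz)

/-- The adjoint equation `Υ' = -(N + h) Υ` has a solution close to `1 - z N`, where `N² = 0`. -/
theorem exists_hasDerivAt_neg_mul [NormOneClass 𝔸] [CompleteSpace 𝔸] {N : 𝔸} (hN : N * N = 0)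
    {h : ℂ → 𝔸} {r κ : ℝ} (hr : 0 < r) (hh : DifferentiableOn ℂ h (Metric.ball 0 r))
    (hκ : ∀ z ∈ Metric.ball (0 : ℂ) r, ‖h z‖ ≤ κ) (hsmall : (1 + r * ‖N‖) ^ 2 * κ * r ≤ 1 / 2) :
    ∃ U : ℂ → 𝔸, ∀ z ∈ Metric.ball (0 : ℂ) r,
      HasDerivAt U (-((N + h z) * U z)) z ∧
        ‖U z - (1 - z • N)‖ ≤ 2 * (1 + r * ‖N‖) ^ 3 * κ * r := by
  have hm : 0 ≤ 1 + r * ‖N‖ := by positivity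
  have hd : ∀ z : ℂ, HasDerivAt (fun z : ℂ => 1 - z • N) (-N) z := fun z => by
    simpa using ((hasDerivAt_id z).smul_const N).const_sub 1
  -- Variation of constants: `1 - z N` solves `U' = -N U` because `N² = 0`, and `U = (1 - z N) V`
  -- turns the equation into one for `V` with small coefficient `-(1 + z N) h (1 - z N)`.
  obtain ⟨V, hV⟩ := exists_hasDerivAt_mul_of_norm_le
    (E := fun z => -((1 + z • N) * h z * (1 - z • N))) (r := r) (e := (1 + r * ‖N‖) ^ 2 * κ) hr
    (by
      refine DifferentiableOn.neg (DifferentiableOn.mul (DifferentiableOn.mul ?_ hh) ?_)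
      · exact (differentiableOn_const 1).add (differentiableOn_id.smul_const N)
      · exact (differentiableOn_const 1).sub (differentiableOn_id.smul_const N))
    (fun z hz => by
      have hz' : ‖z‖ ≤ r := by simpa using (Metric.mem_ball.1 hz).le
      have hκ0 : 0 ≤ κ := (norm_nonneg _).trans (hκ z hz)
      rw [norm_neg]
      calc _ ≤ ‖1 + z • N‖ * ‖h z‖ * ‖1 - z • N‖ :=
            (norm_mul_le _ _).trans (mul_le_mul_of_nonneg_right (norm_mul_le _ _) (norm_nonneg _))
        _ ≤ (1 + r * ‖N‖) * κ * (1 + r * ‖N‖) := by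
            gcongr
            · exact norm_one_add_smul_le N hz'
            · exact hκ z hz
            · exact norm_one_sub_smul_le N hz'
        _ = _ := by ring) hsmall
  refine ⟨fun z => (1 - z • N) * V z, fun z hz => ⟨?_, ?_⟩⟩
  · refine ((hd z).mul (hV z hz).1).congr_deriv (Eq.symm ?_)
    have e : (1 - z • N) * (1 + z • N) = 1 := one_sub_smul_mul_one_add_smul hN z
    have e2 : N * (1 - z • N) = N := by simp [mul_sub, hN]
    change -((N + h z) * ((1 - z • N) * V z)) = _
    generalize z • N = Z at e e2 ⊢
    calc -((N + h z) * ((1 - Z) * V z))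
        = -(N * (1 - Z)) * V z - 1 * h z * (1 - Z) * V z := by noncomm_ring
      _ = -N * V z - ((1 - Z) * (1 + Z)) * h z * (1 - Z) * V z := by rw [e2, e]
      _ = _ := by noncomm_ring
  · have e : (1 - z • N) * V z - (1 - z • N) = (1 - z • N) * (V z - 1) := by noncomm_ring
    have hz' : ‖z‖ ≤ r := by simpa using (Metric.mem_ball.1 hz).le
    rw [e]
    calc _ ≤ (1 + r * ‖N‖) * (2 * ((1 + r * ‖N‖) ^ 2 * κ * r)) :=
          (norm_mul_le _ _).trans (mul_le_mul (norm_one_sub_smul_le N hz') (hV z hz).2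
            (norm_nonneg _) hm)
      _ = _ := by ring

/-- The leading term of the monodromy, divided by `2 π i`. -/
def residueTerm (N A B C : 𝔸) : 𝔸 := -(N * A * N) + (N * B - B * N) + C

/-- The path above the circle of radius `|exp w₀|`. -/
def circlePath (w₀ : ℂ) (s : ℝ) : ℂ := Complex.exp (w₀ + s * Complex.I)

theorem circlePath_ne_zero (w₀ : ℂ) (s : ℝ) : circlePath w₀ s ≠ 0 := Complex.exp_ne_zero _

theorem norm_circlePath (w₀ : ℂ) (s : ℝ) : ‖circlePath w₀ s‖ = Real.exp w₀.re := by
  simp [circlePath, Complex.norm_exp]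

theorem circlePath_two_pi (w₀ : ℂ) : circlePath w₀ (2 * Real.pi) = circlePath w₀ 0 := by
  have := Complex.exp_periodic w₀
  simpa [circlePath] using this

theorem hasDerivAt_circlePath (w₀ : ℂ) (s : ℝ) :
    HasDerivAt (circlePath w₀) (Complex.I * circlePath w₀ s) s := by
  have h : HasDerivAt (fun s : ℝ => w₀ + s * Complex.I) (1 * Complex.I) s :=
    (((hasDerivAt_id s).ofReal_comp).mul_const Complex.I).const_add w₀
  refine h.cexp.congr_deriv ?_
  simp only [circlePath]
  ring

/-- A primitive of `(1 + z N) P (1 - z N)` along the circle, where `P` is the principal part. -/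
def principalPrimitive (N A B C : 𝔸) (w₀ : ℂ) (s : ℝ) : 𝔸 :=
  (s * Complex.I) • residueTerm N A B C + circlePath w₀ s • ((N * C - C * N) - N * B * N)
    - ((1 / 2 : ℂ) * circlePath w₀ s ^ 2) • (N * C * N)
    - (circlePath w₀ s)⁻¹ • ((N * A - A * N) + B)
    - ((1 / 2 : ℂ) * ((circlePath w₀ s)⁻¹) ^ 2) • A

/-- In the expansion of `(1 + z N) P (1 - z N)` the coefficient of `z⁻¹` is `residueTerm`; along the
circle it contributes the linear term in `s`, and all other powers of `z` have powers of `z` as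
primitives. -/
theorem hasDerivAt_principalPrimitive (N A B C : 𝔸) (w₀ : ℂ) (s : ℝ) :
    HasDerivAt (principalPrimitive N A B C w₀)
      ((1 + circlePath w₀ s • N) * ((Complex.I * circlePath w₀ s) •
        ((circlePath w₀ s ^ 3)⁻¹ • A + (circlePath w₀ s ^ 2)⁻¹ • B + (circlePath w₀ s)⁻¹ • C)) *
          (1 - circlePath w₀ s • N)) s := by
  have hz := hasDerivAt_circlePath w₀ s
  have hne := circlePath_ne_zero w₀ s
  have hi := hz.fun_inv hne
  have hs : HasDerivAt (fun s : ℝ => (s : ℂ) * Complex.I) (1 * Complex.I) s :=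
    ((hasDerivAt_id s).ofReal_comp).mul_const Complex.I
  have h := ((((hs.smul_const (residueTerm N A B C)).add
    (hz.smul_const ((N * C - C * N) - N * B * N))).sub
    (((hz.fun_pow 2).const_mul (1 / 2 : ℂ)).smul_const (N * C * N))).sub
    (hi.smul_const ((N * A - A * N) + B))).sub
    (((hi.fun_pow 2).const_mul (1 / 2 : ℂ)).smul_const A)
  refine h.congr_deriv ?_
  set z := circlePath w₀ s
  simp only [residueTerm, mul_add, mul_sub, add_mul, smul_mul_assoc, mul_smul_comm,
    mul_one, one_mul, smul_add, smul_sub, smul_smul, mul_assoc]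
  match_scalars <;> field_simp <;> norm_num
  ring_nf
  field_simp

/-- All terms except the linear one depend on `s` through `circlePath` alone and cancel after a full
turn. -/
theorem principalPrimitive_sub (N A B C : 𝔸) (w₀ : ℂ) :
    principalPrimitive N A B C w₀ (2 * Real.pi) - principalPrimitive N A B C w₀ 0 =
      (2 * Real.pi * Complex.I) • residueTerm N A B C := by
  simp only [principalPrimitive, circlePath_two_pi]
  push_cast
  simp

/-- The difference of the end values of a solution with small principal part, to first order in the
principal part. -/
theorem exists_norm_sub_residueTerm_le [NormOneClass 𝔸] [CompleteSpace 𝔸] {N : 𝔸}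
    (hN : N * N = 0) (G : 𝔸) {w₀ : ℂ} {r R : ℝ} (hr : Real.exp w₀.re < r) (hrR : r < R) :
    ∃ K > 0, ∃ κ₀ > 0, ∀ κ, 0 ≤ κ → κ ≤ κ₀ → ∀ (ξ h : ℂ → 𝔸) (φ : ℝ → 𝔸) (A B C : 𝔸),
      DifferentiableOn ℂ h (Metric.ball 0 R) →
      (∀ z : ℂ, z ≠ 0 → ‖z‖ ≤ r →
        ξ z = N + ((z ^ 3)⁻¹ • A + (z ^ 2)⁻¹ • B + z⁻¹ • C + h z)) →
      (∀ z : ℂ, ‖z‖ = r → ‖ξ z - N‖ ≤ κ) →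
      (∀ s ∈ Icc (0 : ℝ) (2 * Real.pi), HasDerivAt φ
        (φ s * ((Complex.I * circlePath w₀ s) • ξ (circlePath w₀ s))) s) →
      (∀ s ∈ Icc (0 : ℝ) (2 * Real.pi), ‖φ s - G * (1 + circlePath w₀ s • N)‖ ≤ κ) →
      ∃ U : 𝔸, ‖φ 0 * U - G‖ ≤ K * κ ∧
        ‖(φ (2 * Real.pi) - φ 0) * U - G * ((2 * Real.pi * Complex.I) • residueTerm N A B C)‖ ≤
          K * κ * (‖A‖ + ‖B‖ + ‖C‖) := by
  have hr₁ : 0 < Real.exp w₀.re := Real.exp_pos _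
  set r₁ := Real.exp w₀.re with hr₁def
  have hr0 : 0 < r := hr₁.trans hr
  set m := 1 + r * ‖N‖ with hm
  have hm1 : 1 ≤ m := by have : 0 ≤ r * ‖N‖ := by positivity
                         linarith
  have hm0 : 0 < m := by linarith
  -- With `‖h‖ ≤ 8 κ`, the bound `2 m³ (8 κ) r` for the distance from `U` to `1 - z N` is `L κ`.
  set L := 16 * m ^ 3 * r with hL
  have hL0 : 0 < L := by positivity
  -- A bound for `z P(z)` on the circle of radius `r₁`, relative to `‖A‖ + ‖B‖ + ‖C‖`.
  set c := (r₁ ^ 2)⁻¹ + r₁⁻¹ + 1 with hc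
  have hc0 : 0 < c := by positivity
  set K₂ := (m + L) + ‖G‖ * m * L with hK₂
  have hK₂0 : 0 < K₂ := by positivity
  refine ⟨K₂ + c * K₂ * (2 * Real.pi), by positivity,
    min 1 (m ^ 2 * 8 * r * 2)⁻¹, by positivity, ?_⟩
  intro κ hκ0 hκ ξ h φ A B C hh hξ hξκ hφ hφκ
  have hκ1 : κ ≤ 1 := hκ.trans (min_le_left _ _)
  have hκ2 : κ ≤ (m ^ 2 * 8 * r * 2)⁻¹ := hκ.trans (min_le_right _ _)
  have hne : ∀ z : ℂ, ‖z‖ = r → z ≠ 0 := by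
    rintro z hz rfl
    rw [norm_zero] at hz
    exact hr0.ne hz
  obtain ⟨-, -, -, hhκ⟩ := norm_principalPart_le (f := fun z => ξ z - N) (a := A) (b := B) (c := C)
    hr0 hrR hh (fun z hz => by rw [hξ z (hne z hz) hz.le, add_sub_cancel_left]) hξκ
  have hsmall : m ^ 2 * (8 * κ) * r ≤ 1 / 2 := by
    have h1 : κ * (m ^ 2 * 8 * r * 2) ≤ 1 := by
      rw [← le_div_iff₀ (by positivity), one_div]
      exact hκ2
    linarith
  obtain ⟨U, hU⟩ := exists_hasDerivAt_neg_mul hN hr0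
    (hh.mono (Metric.ball_subset_ball hrR.le))
    (fun z hz => hhκ z (by simpa using (Metric.mem_ball.1 hz).le)) hsmall
  have hball : ∀ s, circlePath w₀ s ∈ Metric.ball (0 : ℂ) r := fun s => by
    simpa [norm_circlePath] using hr
  have hle : ∀ s, ‖circlePath w₀ s‖ ≤ r := fun s => by
    rw [norm_circlePath]
    exact hr.le
  have hUd : ∀ s, ‖U (circlePath w₀ s) - (1 - circlePath w₀ s • N)‖ ≤ L * κ := fun s =>
    ((hU _ (hball s)).2).trans (le_of_eq (by rw [hL]; ring))
  have hUn : ∀ s, ‖U (circlePath w₀ s)‖ ≤ m + L := fun s => by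
    have h1 := norm_add_le (U (circlePath w₀ s) - (1 - circlePath w₀ s • N))
      (1 - circlePath w₀ s • N)
    rw [sub_add_cancel] at h1
    have h2 := norm_one_sub_smul_le N (hle s)
    have h3 : L * κ ≤ L := mul_le_of_le_one_right hL0.le hκ1
    linarith [hUd s]
  -- Replacing both outer factors by their unperturbed values costs an error linear in `P`. The
  -- choice `P = 1` gives the first estimate; the polar part gives the second, whose error carries
  -- the factor `‖A‖ + ‖B‖ + ‖C‖`.
  have hdiff : ∀ s ∈ Icc (0 : ℝ) (2 * Real.pi), ∀ P : 𝔸,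
      ‖φ s * P * U (circlePath w₀ s) -
        G * ((1 + circlePath w₀ s • N) * P * (1 - circlePath w₀ s • N))‖ ≤ ‖P‖ * (K₂ * κ) := by
    intro s hs P
    set z := circlePath w₀ s
    have e : φ s * P * U z - G * ((1 + z • N) * P * (1 - z • N)) =
        (φ s - G * (1 + z • N)) * P * U z +
          G * (1 + z • N) * P * (U z - (1 - z • N)) := by
      simp only [sub_mul, mul_sub, mul_assoc]
      abel
    rw [e]
    calc _ ≤ ‖φ s - G * (1 + z • N)‖ * ‖P‖ * ‖U z‖ +
          ‖G‖ * ‖1 + z • N‖ * ‖P‖ * ‖U z - (1 - z • N)‖ := by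
          refine (norm_add_le _ _).trans (add_le_add ?_ ?_)
          · refine (norm_mul_le _ _).trans ?_
            gcongr
            exact norm_mul_le _ _
          · refine (norm_mul_le _ _).trans ?_
            gcongr
            refine (norm_mul_le _ _).trans ?_
            gcongr
            exact norm_mul_le _ _
      _ ≤ κ * ‖P‖ * (m + L) + ‖G‖ * m * ‖P‖ * (L * κ) := by
          gcongr
          · exact hφκ s hs
          · exact hUn s
          · exact norm_one_add_smul_le N (hle s)
          · exact hUd s
      _ = ‖P‖ * (K₂ * κ) := by rw [hK₂]; ring
  have hpi : (0 : ℝ) ≤ 2 * Real.pi := by positivity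
  have h0mem : (0 : ℝ) ∈ Icc (0 : ℝ) (2 * Real.pi) := ⟨le_rfl, hpi⟩
  refine ⟨U (circlePath w₀ 0), ?_, ?_⟩
  · have h1 := hdiff 0 h0mem 1
    rw [mul_one, mul_one, one_add_smul_mul_one_sub_smul hN, mul_one, norm_one, one_mul] at h1
    refine h1.trans (mul_le_mul_of_nonneg_right ?_ hκ0)
    have : 0 ≤ c * K₂ * (2 * Real.pi) := by positivity
    linarith
  · set P : ℝ → 𝔸 := fun s => (Complex.I * circlePath w₀ s) •
        ((circlePath w₀ s ^ 3)⁻¹ • A + (circlePath w₀ s ^ 2)⁻¹ • B + (circlePath w₀ s)⁻¹ • C)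
      with hP
    have hPn : ∀ s, ‖P s‖ ≤ c * (‖A‖ + ‖B‖ + ‖C‖) := by
      intro s
      have hn := norm_circlePath w₀ s
      rw [← hr₁def] at hn
      have e : P s = (Complex.I * (circlePath w₀ s ^ 2)⁻¹) • A +
          (Complex.I * (circlePath w₀ s)⁻¹) • B + Complex.I • C := by
        have := circlePath_ne_zero w₀ s
        simp only [hP]
        match_scalars <;> field_simp
      rw [e]
      refine (norm_add₃_le).trans ?_
      simp only [norm_smul, norm_mul, Complex.norm_I, one_mul, norm_inv, norm_pow, hn]
      have h1 : 0 ≤ (r₁ ^ 2)⁻¹ := by positivity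
      have h2 : 0 ≤ r₁⁻¹ := by positivity
      have h3 := norm_nonneg A
      have h4 := norm_nonneg B
      have h5 := norm_nonneg C
      rw [hc]
      nlinarith [mul_nonneg h1 h4, mul_nonneg h1 h5, mul_nonneg h2 h3, mul_nonneg h2 h5]
    -- The terms with `N + h` from `φ'` and from `U'` cancel, leaving only the polar part between
    -- `φ` and `U`.
    have hder : ∀ s ∈ Icc (0 : ℝ) (2 * Real.pi),
        HasDerivAt (fun s => φ s * U (circlePath w₀ s) - G * principalPrimitive N A B C w₀ s)
          (φ s * P s * U (circlePath w₀ s) -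
            G * ((1 + circlePath w₀ s • N) * P s * (1 - circlePath w₀ s • N))) s := by
      intro s hs
      have h1 := (hU _ (hball s)).1.scomp s (hasDerivAt_circlePath w₀ s)
      have h2 := ((hφ s hs).mul h1).sub ((hasDerivAt_principalPrimitive N A B C w₀ s).const_mul G)
      refine h2.congr_deriv ?_
      congr 1
      rw [hξ _ (circlePath_ne_zero w₀ s) (hle s)]
      simp only [hP, Function.comp]
      simp only [smul_add, mul_add, add_mul, smul_mul_assoc, mul_smul_comm, smul_neg, mul_neg,
        smul_smul, mul_assoc]
      abel
    have hmv := norm_image_sub_le_of_norm_deriv_le_segment'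
      (fun s hs => (hder s hs).hasDerivWithinAt)
      (fun s hs => (hdiff s ⟨hs.1, hs.2.le⟩ (P s)).trans
        (mul_le_mul_of_nonneg_right (hPn s) (by positivity))) (2 * Real.pi) ⟨hpi, le_rfl⟩
    -- `U` is defined on the disk, so it takes the same value at both ends of the path.
    have e : φ (2 * Real.pi) * U (circlePath w₀ (2 * Real.pi)) -
        G * principalPrimitive N A B C w₀ (2 * Real.pi) -
        (φ 0 * U (circlePath w₀ 0) - G * principalPrimitive N A B C w₀ 0) =
        (φ (2 * Real.pi) - φ 0) * U (circlePath w₀ 0) -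
          G * ((2 * Real.pi * Complex.I) • residueTerm N A B C) := by
      rw [← principalPrimitive_sub N A B C w₀, circlePath_two_pi]
      simp only [sub_mul, mul_sub]
      abel
    rw [e] at hmv
    refine hmv.trans ?_
    have h1 : 0 ≤ K₂ * κ * (‖A‖ + ‖B‖ + ‖C‖) := by positivity
    calc c * (‖A‖ + ‖B‖ + ‖C‖) * (K₂ * κ) * (2 * Real.pi - 0)
        = (c * K₂ * (2 * Real.pi)) * κ * (‖A‖ + ‖B‖ + ‖C‖) := by ring
      _ ≤ (K₂ + c * K₂ * (2 * Real.pi)) * κ * (‖A‖ + ‖B‖ + ‖C‖) := by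
          gcongr
          linarith

end BanachAlgebra

/-- Passage from `(M - 1) K = G X + …` with `K` close to `G` to `M - 1 = G X G⁻¹ + …`. -/
theorem norm_sub_one_sub_conj_le {𝔸 : Type*} [NormedRing 𝔸] {G G' M K X : 𝔸}
    {e τ C : ℝ} (hG : G * G' = 1)
    (he : e * ‖G'‖ ≤ 1 / 2) (he1 : e ≤ 1) (hτ : 0 ≤ τ) (hX : ‖X‖ ≤ C * τ)
    (hK : ‖K - G‖ ≤ e) (hM : ‖(M - 1) * K - G * X‖ ≤ e * τ) :
    ‖M - 1 - G * X * G'‖ ≤ e * τ * ‖G'‖ * (1 + 2 * ‖G'‖ * (‖G‖ * C + 1)) := by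
  set D := (M - 1) * K with hD
  -- `M - 1` occurs on both sides; the estimate `hm` absorbs the right-hand occurrence by means of
  -- `e * ‖G'‖ ≤ 1 / 2`.
  have e1 : M - 1 = (D - (M - 1) * (K - G)) * G' := by
    rw [hD, ← mul_sub, sub_sub_cancel, mul_assoc, hG, mul_one]
  have hDn : ‖D‖ ≤ (‖G‖ * C + 1) * τ := by
    have h1 := norm_add_le (D - G * X) (G * X)
    rw [sub_add_cancel] at h1
    have h2 : ‖G * X‖ ≤ ‖G‖ * (C * τ) :=
      (norm_mul_le _ _).trans (mul_le_mul_of_nonneg_left hX (norm_nonneg _))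
    nlinarith
  have hm : ‖M - 1‖ ≤ 2 * ‖G'‖ * ((‖G‖ * C + 1) * τ) := by
    have h1 : ‖M - 1‖ ≤ (‖D‖ + ‖M - 1‖ * e) * ‖G'‖ := by
      conv_lhs => rw [e1]
      refine (norm_mul_le _ _).trans (mul_le_mul_of_nonneg_right ?_ (norm_nonneg _))
      refine (norm_sub_le _ _).trans (add_le_add le_rfl ?_)
      exact (norm_mul_le _ _).trans (mul_le_mul_of_nonneg_left hK (norm_nonneg _))
    have h2 : ‖M - 1‖ * (e * ‖G'‖) ≤ ‖M - 1‖ * (1 / 2) :=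
      mul_le_mul_of_nonneg_left he (norm_nonneg _)
    have h3 : ‖D‖ * ‖G'‖ ≤ (‖G‖ * C + 1) * τ * ‖G'‖ :=
      mul_le_mul_of_nonneg_right hDn (norm_nonneg _)
    nlinarith
  have e2 : M - 1 - G * X * G' = ((D - G * X) - (M - 1) * (K - G)) * G' := by
    conv_lhs => rw [e1]
    simp only [sub_mul]
    abel
  rw [e2]
  calc _ ≤ (e * τ + 2 * ‖G'‖ * ((‖G‖ * C + 1) * τ) * e) * ‖G'‖ := by
        refine (norm_mul_le _ _).trans (mul_le_mul_of_nonneg_right ?_ (norm_nonneg _))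
        refine (norm_sub_le _ _).trans (add_le_add hM ?_)
        exact (norm_mul_le _ _).trans (mul_le_mul hm hK (norm_nonneg _) ((norm_nonneg _).trans hm))
    _ = _ := by ring

theorem norm_residueTerm_le {𝔸 : Type*} [NormedRing 𝔸] (N A B C : 𝔸) :
    ‖residueTerm N A B C‖ ≤ (‖N‖ + 1) ^ 2 * (‖A‖ + ‖B‖ + ‖C‖) := by
  have h1 : ‖N * A * N‖ ≤ ‖N‖ * ‖A‖ * ‖N‖ :=
    (norm_mul_le _ _).trans (mul_le_mul_of_nonneg_right (norm_mul_le _ _) (norm_nonneg _))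
  have h2 : ‖N * B - B * N‖ ≤ 2 * ‖N‖ * ‖B‖ := by
    have h3 := norm_sub_le (N * B) (B * N)
    have h4 := norm_mul_le N B
    have h5 := norm_mul_le B N
    linarith
  have h3 : ‖residueTerm N A B C‖ ≤ ‖N * A * N‖ + ‖N * B - B * N‖ + ‖C‖ := by
    rw [← norm_neg (N * A * N)]
    exact norm_add₃_le
  have hN := norm_nonneg N
  have hA := norm_nonneg A
  have hB := norm_nonneg B
  have hC := norm_nonneg C
  nlinarith [mul_nonneg hN hA, mul_nonneg hN hC, mul_nonneg (sq_nonneg ‖N‖) hB,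
    mul_nonneg (sq_nonneg ‖N‖) hC]

/-- First order expansion of the monodromy of a perturbation of the equation `Φ' = Φ N`, with
`N² = 0`, by a coefficient with a pole of order at most three at the origin. -/
theorem exists_norm_monodromy_sub_le {𝔸 : Type*} [NormedRing 𝔸] [NormedAlgebra ℂ 𝔸]
    [NormOneClass 𝔸] [CompleteSpace 𝔸] {N G G' : 𝔸} (hN : N * N = 0) (hG : G * G' = 1) {w₀ : ℂ}
    {r R : ℝ} (hr : Real.exp w₀.re < r) (hrR : r < R) {η : ℝ} (hη : 0 < η) :
    ∃ κ > 0, ∀ (ξ h : ℂ → 𝔸) (φ : ℝ → 𝔸) (ψ A B C : 𝔸),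
      DifferentiableOn ℂ h (Metric.ball 0 R) →
      (∀ z : ℂ, z ≠ 0 → ‖z‖ ≤ r →
        ξ z = N + ((z ^ 3)⁻¹ • A + (z ^ 2)⁻¹ • B + z⁻¹ • C + h z)) →
      (∀ z : ℂ, ‖z‖ = r → ‖ξ z - N‖ ≤ κ) →
      (∀ s ∈ Icc (0 : ℝ) (2 * Real.pi), HasDerivAt φ
        (φ s * ((Complex.I * circlePath w₀ s) • ξ (circlePath w₀ s))) s) →
      (∀ s ∈ Icc (0 : ℝ) (2 * Real.pi), ‖φ s - G * (1 + circlePath w₀ s • N)‖ ≤ κ) →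
      ψ * φ 0 = 1 →
      ‖φ (2 * Real.pi) * ψ - 1 - G * ((2 * Real.pi * Complex.I) • residueTerm N A B C) * G'‖ ≤
          η * (‖A‖ + ‖B‖ + ‖C‖) := by
  obtain ⟨K, hK, κ₀, hκ₀, key⟩ := exists_norm_sub_residueTerm_le hN G hr hrR
  set C₀ := ‖(2 * Real.pi * Complex.I : ℂ)‖ * (‖N‖ + 1) ^ 2 with hC₀
  set L := ‖G'‖ * (1 + 2 * ‖G'‖ * (‖G‖ * C₀ + 1)) with hL
  have hL0 : 0 ≤ L := by positivity
  -- The first bound allows the preceding expansion, the second makes `e = K κ` satisfy `e ‖G'‖ ≤ 1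
  -- / 2` and `e ≤ 1`, and the third brings the final constant `K κ L` below `η`.
  refine ⟨min κ₀ (min (K * (2 * ‖G'‖ + 1))⁻¹ (η * (K * (L + 1))⁻¹)), by positivity, ?_⟩
  set κ := min κ₀ (min (K * (2 * ‖G'‖ + 1))⁻¹ (η * (K * (L + 1))⁻¹)) with hκ
  have hκ0 : 0 ≤ κ := by positivity
  have hκ1 : κ ≤ κ₀ := min_le_left _ _
  have hκ2 : K * κ * (2 * ‖G'‖ + 1) ≤ 1 := by
    have h1 : κ ≤ (K * (2 * ‖G'‖ + 1))⁻¹ := (min_le_right _ _).trans (min_le_left _ _)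
    rw [← one_div, le_div_iff₀ (by positivity)] at h1
    linarith
  have hκ3 : K * κ * (L + 1) ≤ η := by
    have h1 : κ ≤ η * (K * (L + 1))⁻¹ := (min_le_right _ _).trans (min_le_right _ _)
    rw [← div_eq_mul_inv, le_div_iff₀ (by positivity)] at h1
    linarith
  have hKκ : 0 ≤ K * κ := by positivity
  have hKG : 0 ≤ K * κ * ‖G'‖ := by positivity
  intro ξ h φ ψ A B C hh hξ hξκ hφ hφκ hψ
  obtain ⟨U, hU1, hU2⟩ := key κ hκ0 hκ1 ξ h φ A B C hh hξ hξκ hφ hφκ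
  have hτ : 0 ≤ ‖A‖ + ‖B‖ + ‖C‖ := by positivity
  have hX : ‖(2 * Real.pi * Complex.I : ℂ) • residueTerm N A B C‖ ≤ C₀ * (‖A‖ + ‖B‖ + ‖C‖) := by
    rw [norm_smul, hC₀]
    exact (mul_le_mul_of_nonneg_left (norm_residueTerm_le N A B C)
      (norm_nonneg (2 * Real.pi * Complex.I : ℂ))).trans_eq (by ring)
  have e : (φ (2 * Real.pi) * ψ - 1) * (φ 0 * U) = (φ (2 * Real.pi) - φ 0) * U := by
    rw [sub_mul, sub_mul, one_mul, mul_assoc, ← mul_assoc ψ, hψ, one_mul]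
  refine (norm_sub_one_sub_conj_le (K := φ 0 * U) (e := K * κ) hG (by linarith)
    (by nlinarith [norm_nonneg G']) hτ hX hU1 (by rw [e]; exact hU2)).trans ?_
  calc _ = K * κ * L * (‖A‖ + ‖B‖ + ‖C‖) := by rw [hL]; ring
    _ ≤ η * (‖A‖ + ‖B‖ + ‖C‖) := by
        refine mul_le_mul_of_nonneg_right ?_ hτ
        linarith

/-! ### Laurent polynomials vanishing to high order at `λ = 1`. -/

open Filter Topology

/-- A polynomial in `u` of degree four that is `o(u²)` has no terms of degree at most two. -/
theorem coeff_eq_zero_of_tendsto_div_sq {e₀ e₁ e₂ e₃ e₄ : ℂ} {F : ℂ → ℂ}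
    (hF : ∀ᶠ u in 𝓝[≠] 0, F u = e₀ + e₁ * u + e₂ * u ^ 2 + e₃ * u ^ 3 + e₄ * u ^ 4)
    (h : Tendsto (fun u => F u / u ^ 2) (𝓝[≠] 0) (𝓝 0)) : e₀ = 0 ∧ e₁ = 0 ∧ e₂ = 0 := by
  have hid : Tendsto (fun u : ℂ => u) (𝓝[≠] 0) (𝓝 0) := tendsto_id.mono_left nhdsWithin_le_nhds
  have hne : ∀ᶠ u : ℂ in 𝓝[≠] 0, u ≠ 0 := eventually_mem_nhdsWithin
  have hp : ∀ g : ℂ → ℂ, Continuous g → Tendsto g (𝓝[≠] 0) (𝓝 (g 0)) := fun g hg =>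
    (hg.tendsto 0).mono_left nhdsWithin_le_nhds
  have h0 : e₀ = 0 := by
    have h1 := hp (fun u => e₀ + e₁ * u + e₂ * u ^ 2 + e₃ * u ^ 3 + e₄ * u ^ 4) (by fun_prop)
    have h2 := h.mul (hid.pow 2)
    simp only [mul_zero, zero_pow two_ne_zero, ne_eq, OfNat.ofNat_ne_zero, not_false_eq_true,
      zero_pow, add_zero] at h1 h2
    refine tendsto_nhds_unique h1 (h2.congr' ?_)
    filter_upwards [hF, hne] with u hu hu0
    rw [← hu]
    field_simp
  have h1 : e₁ = 0 := by
    have h1 := hp (fun u => e₁ + e₂ * u + e₃ * u ^ 2 + e₄ * u ^ 3) (by fun_prop)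
    have h2 := h.mul hid
    simp only [mul_zero, ne_eq, OfNat.ofNat_ne_zero, not_false_eq_true,
      zero_pow, add_zero] at h1 h2
    refine tendsto_nhds_unique h1 (h2.congr' ?_)
    filter_upwards [hF, hne] with u hu hu0
    rw [hu, h0]
    field_simp
    ring
  refine ⟨h0, h1, ?_⟩
  have h2 := hp (fun u => e₂ + e₃ * u + e₄ * u ^ 2) (by fun_prop)
  simp only [mul_zero, ne_eq, OfNat.ofNat_ne_zero, not_false_eq_true,
      zero_pow, add_zero] at h2
  refine tendsto_nhds_unique h2 (h.congr' ?_)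
  filter_upwards [hF, hne] with u hu hu0
  rw [hu, h0, h1]
  field_simp
  ring

namespace W

variable {ρ : ℝ} [Fact (1 < ρ)]

theorem coeff_mul_eq_zero {f g : W ρ} (hf : ∀ i < 0, f.coeff i = 0) (hg : ∀ i < 0, g.coeff i = 0)
    {n : ℤ} (hn : n < 0) : (f * g).coeff n = 0 := by
  rw [coeff_mul]
  refine (tsum_congr fun k => ?_).trans tsum_zero
  by_cases hk : k < 0
  · rw [hf k hk, zero_mul]
  · rw [hg _ (by omega), mul_zero]

theorem coeff_mul_zero {f g : W ρ} (hf : ∀ i < 0, f.coeff i = 0) (hg : ∀ i < 0, g.coeff i = 0) :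
    (f * g).coeff 0 = f.coeff 0 * g.coeff 0 := by
  rw [coeff_mul, tsum_eq_single 0, sub_zero]
  intro k hk
  by_cases hk' : k < 0
  · rw [hf k hk', zero_mul]
  · rw [hg _ (by omega), mul_zero]

/-- A function on the circle that vanishes to second order at `1`, divided by `lam - 1`. -/
theorem tendsto_eval_div {f : W ρ} (h0 : f.eval 1 = 0) (h1 : derivOne f = 0) :
    Tendsto (fun u : ℂ => f.eval (1 + u) / u) (𝓝[≠] 0) (𝓝 0) := by
  have h := f.hasDerivAt_eval_one
  rw [h1, hasDerivAt_iff_tendsto_slope_zero] at h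
  refine h.congr fun u => ?_
  rw [h0, sub_zero, smul_eq_mul, inv_mul_eq_div]

/-- A real function on the circle with degrees between `-2` and `2` that is `o((lam - 1)²)` is a
multiple of `(lam - 1)⁴ / lam²`. -/
theorem eval_neg_one_eq {d : W ρ} (hd : ∀ i < -2, d.coeff i = 0) (hstar : star d = d)
    (hreal : star (d.coeff (-2)) = d.coeff (-2))
    (hlim : Tendsto (fun u : ℂ => d.eval (1 + u) / u ^ 2) (𝓝[≠] 0) (𝓝 0)) :
    d.eval (-1) = 16 * d.coeff (-2) ∧
      (d.coeff (-2) = 0 → d = 0) := by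
  have hs : ∀ i, d.coeff i = star (d.coeff (-i)) := fun i => by rw [← coeff_star, hstar]
  have hd' : ∀ i, 2 < i → d.coeff i = 0 := fun i hi => by
    rw [hs, hd _ (by omega), star_zero]
  have h2 : d.coeff 2 = d.coeff (-2) := by rw [hs, hreal]
  have heval : ∀ lam : ℂ, d.eval lam = d.coeff (-2) * lam ^ (-2 : ℤ) + d.coeff (-1) * lam ^ (-1 : ℤ)
      + d.coeff 0 + d.coeff 1 * lam + d.coeff (-2) * lam ^ 2 := by
    intro lam
    rw [eval, tsum_eq_sum (s := {-2, -1, 0, 1, 2})]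
    · simp [h2]
      norm_cast
      ring
    · intro i hi
      simp only [Finset.mem_insert, Finset.mem_singleton, not_or] at hi
      by_cases h : i < -2
      · rw [hd i h, zero_mul]
      · rw [hd' i (by omega), zero_mul]
  set k := d.coeff (-2)
  set β := d.coeff (-1)
  set γ := d.coeff 0
  set δ := d.coeff 1
  have hone : Tendsto (fun u : ℂ => (1 + u) ^ 2) (𝓝[≠] 0) (𝓝 1) := by
    have : Tendsto (fun u : ℂ => (1 + u) ^ 2) (𝓝 0) (𝓝 ((1 + 0) ^ 2)) :=
      Continuous.tendsto (by fun_prop) 0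
    rw [add_zero, one_pow] at this
    exact this.mono_left nhdsWithin_le_nhds
  -- Multiplication by `λ²` gives a polynomial of degree four; `e₀, …, e₄` are its Taylor
  -- coefficients at `λ = 1`, in `u = λ - 1`.
  obtain ⟨e0, e1, e2⟩ := coeff_eq_zero_of_tendsto_div_sq
    (F := fun u => d.eval (1 + u) * (1 + u) ^ 2)
    (e₀ := 2 * k + β + γ + δ) (e₁ := β + 2 * γ + 3 * δ + 4 * k) (e₂ := γ + 3 * δ + 6 * k)
    (e₃ := δ + 4 * k) (e₄ := k) (by
      have : ∀ᶠ u : ℂ in 𝓝[≠] 0, 1 + u ≠ 0 := by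
        refine nhdsWithin_le_nhds ?_
        have hc : Continuous fun u : ℂ => 1 + u := by fun_prop
        exact hc.continuousAt.eventually_ne (by simp)
      filter_upwards [this] with u hu
      rw [heval, zpow_neg, zpow_neg_one]
      norm_cast
      field_simp
      ring) (by
      have := hlim.mul hone
      rw [zero_mul] at this
      exact this.congr fun u => by ring)
  -- The coefficients are those of `k (λ - 1)⁴`, whence the value `16 k` at `λ = -1`.
  have hδ : δ = -4 * k := by linear_combination e0 - e1 + e2
  have hβ : β = -4 * k := by linear_combination e1 - 2 * e2 + 3 * hδ
  have hγ : γ = 6 * k := by linear_combination e2 - 3 * hδ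
  refine ⟨?_, fun hk => ?_⟩
  · rw [heval, hδ, hβ, hγ]
    norm_num
    ring
  · ext i
    rw [coeff_zero]
    by_cases h : i < -2
    · exact hd i h
    by_cases h' : 2 < i
    · exact hd' i h'
    obtain rfl | rfl | rfl | rfl | rfl : i = -2 ∨ i = -1 ∨ i = 0 ∨ i = 1 ∨ i = 2 := by omega
    · exact hk
    · rw [show d.coeff (-1) = β from rfl, hβ, hk, mul_zero]
    · rw [show d.coeff 0 = γ from rfl, hγ, hk, mul_zero]
    · rw [show d.coeff 1 = δ from rfl, hδ, hk, mul_zero]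
    · rw [h2, hk]

end W

/-! ### Antihermitian loops and rigidity of the residue. -/

namespace LoopMatrix

theorem eval_apply {ρ : ℝ} (A : LoopMatrix ρ) (lam : ℂ) (i j : Fin 2) :
    A.eval lam i j = (A i j).eval lam := rfl

variable {ρ : ℝ} [Fact (1 < ρ)]

theorem eval_eq_mapMatrix (A : LoopMatrix ρ) {lam : ℂ} (h : lam ∈ W.closedAnnulus ρ) :
    A.eval lam = (W.evalHom h).mapMatrix A := rfl

theorem ext_eval {A B : LoopMatrix ρ} (h : ∀ lam : ℂ, ‖lam‖ = 1 → A.eval lam = B.eval lam) :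
    A = B := by
  ext1 i j
  refine W.ext_eval fun lam hl => ?_
  rw [← eval_apply, h lam hl, eval_apply]

theorem eval_det (A : LoopMatrix ρ) {lam : ℂ} (h : lam ∈ W.closedAnnulus ρ) :
    (A.eval lam).det = A.det.eval lam := by
  rw [eval_eq_mapMatrix A h, ← RingHom.map_det, W.evalHom_apply]

theorem eval_mul (A B : LoopMatrix ρ) {lam : ℂ} (h : lam ∈ W.closedAnnulus ρ) :
    LoopMatrix.eval (A * B) lam = A.eval lam * B.eval lam := by
  rw [eval_eq_mapMatrix _ h, map_mul]
  rfl

theorem IsSL.det_eq_one {A : LoopMatrix ρ} (hA : A.IsSL) : A.det = 1 :=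
  W.ext_eval fun lam hl => by
    rw [← eval_det A (W.mem_closedAnnulus_of_norm_eq_one hl), hA lam hl, W.eval_one]

/-- A trace-free antihermitian loop with vanishing determinant vanishes. -/
theorem eq_zero_of_antihermitian {S : LoopMatrix ρ} (hS : S.conjTranspose = -S)
    (htr : S 1 1 = -S 0 0) :
    (∀ lam : ℂ, ‖lam‖ = 1 → 0 ≤ (S.det.eval lam).re) ∧ (S.det = 0 → S = 0) := by
  -- On the circle the matrix has the form `(x, y; -conj y, conj x)`, whose determinant is `|x|² +
  -- |y|²`.
  have hdet : ∀ lam : ℂ, ‖lam‖ = 1 → S.det.eval lam =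
      ((Complex.normSq ((S 0 0).eval lam) + Complex.normSq ((S 0 1).eval lam) : ℝ) : ℂ) := by
    intro lam hl
    have hl' := W.mem_closedAnnulus_of_norm_eq_one (ρ := ρ) hl
    have h00 : star ((S 0 0).eval lam) = -(S 0 0).eval lam := by
      have := congrFun (congrFun hS 0) 0
      rw [Matrix.conjTranspose_apply, Matrix.neg_apply] at this
      rw [← W.eval_star _ hl, this]
      exact (W.evalHom hl').map_neg _
    have h10 : (S 1 0).eval lam = -star ((S 0 1).eval lam) := by
      have := congrFun (congrFun hS 1) 0
      rw [Matrix.conjTranspose_apply, Matrix.neg_apply] at this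
      rw [← W.eval_star _ hl, this, ← W.evalHom_apply hl' (-S 1 0), map_neg, neg_neg,
        W.evalHom_apply]
    have h11 : (S 1 1).eval lam = star ((S 0 0).eval lam) := by
      rw [h00, htr]
      exact (W.evalHom hl').map_neg _
    rw [← eval_det S hl', Matrix.det_fin_two]
    simp only [eval_apply]
    rw [h10, h11, Complex.ofReal_add, ← Complex.mul_conj, ← Complex.mul_conj]
    simp only [starRingEnd_apply]
    ring
  refine ⟨fun lam hl => ?_, fun h0 => ?_⟩
  · rw [hdet lam hl, Complex.ofReal_re]
    exact add_nonneg (Complex.normSq_nonneg _) (Complex.normSq_nonneg _)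
  · have hz : ∀ lam : ℂ, ‖lam‖ = 1 → (S 0 0).eval lam = 0 ∧ (S 0 1).eval lam = 0 := by
      intro lam hl
      have hl' := W.mem_closedAnnulus_of_norm_eq_one (ρ := ρ) hl
      have h1 := hdet lam hl
      rw [h0, ← W.evalHom_apply hl', map_zero] at h1
      have h2 : Complex.normSq ((S 0 0).eval lam) + Complex.normSq ((S 0 1).eval lam) = 0 := by
        exact_mod_cast h1.symm
      have h3 := Complex.normSq_nonneg ((S 0 0).eval lam)
      have h4 := Complex.normSq_nonneg ((S 0 1).eval lam)
      exact ⟨Complex.normSq_eq_zero.1 (by linarith), Complex.normSq_eq_zero.1 (by linarith)⟩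
    have e00 : S 0 0 = 0 := W.ext_eval fun lam hl => by
      rw [(hz lam hl).1]
      exact ((W.evalHom (W.mem_closedAnnulus_of_norm_eq_one hl)).map_zero).symm
    have e01 : S 0 1 = 0 := W.ext_eval fun lam hl => by
      rw [(hz lam hl).2]
      exact ((W.evalHom (W.mem_closedAnnulus_of_norm_eq_one hl)).map_zero).symm
    have e10 : S 1 0 = 0 := by
      have := congrFun (congrFun hS 1) 0
      rw [Matrix.conjTranspose_apply, Matrix.neg_apply, e01, star_zero] at this
      exact neg_eq_zero.1 this.symm
    ext1 i j
    fin_cases i <;> fin_cases j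
    · exact e00
    · exact e01
    · exact e10
    · exact htr.trans (by rw [e00]; simp)

/-- The loop matrix `2 π i lam⁻¹ (-b, c; -a, b)`. -/
def residueLoop (a b c : W ρ) : LoopMatrix ρ :=
  ((2 * Real.pi * Complex.I : ℂ) • (W.mono (-1) : W ρ)) • !![-b, c; -a, b]

theorem det_residueLoop (a b c : W ρ) :
    (residueLoop a b c).det = (-(4 * Real.pi ^ 2) : ℂ) • (W.mono (-2) * (a * c - b * b)) := by
  have h1 : (W.mono (-1) : W ρ) ^ 2 = W.mono (-2) := by rw [pow_two, W.mono_mul_mono]; rfl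
  have h2 : (2 * Real.pi * Complex.I : ℂ) ^ 2 = -(4 * Real.pi ^ 2) := by
    rw [mul_pow, Complex.I_sq]
    ring
  rw [residueLoop, Matrix.det_smul, Fintype.card_fin, smul_pow, h1, h2, Matrix.det_fin_two_of,
    smul_mul_assoc]
  congr 2
  ring

/-- The conditions on the coefficients of the principal part. -/
structure IsNormalized (a b c : W ρ) : Prop where
  nonneg_a : ∀ i < 0, a.coeff i = 0
  nonneg_b : ∀ i < 0, b.coeff i = 0
  nonneg_c : ∀ i < 0, c.coeff i = 0
  coeff_a : a.coeff 0 = 0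
  re_coeff_b : (b.coeff 0).re = 0

theorem residueLoop_eq_zero {a b c : W ρ} (h : residueLoop a b c = 0) : a = 0 ∧ b = 0 ∧ c = 0 := by
  have hq : ∀ f : W ρ, ((2 * Real.pi * Complex.I : ℂ) • (W.mono (-1) : W ρ)) * f = 0 → f = 0 := by
    intro f hf
    rw [smul_mul_assoc, smul_eq_zero] at hf
    have h1 := hf.resolve_left Complex.two_pi_I_ne_zero
    have h2 : W.mono 1 * (W.mono (-1) * f) = f := by
      rw [← mul_assoc, W.mono_mul_mono, add_neg_cancel, ← W.one_eq_mono, one_mul]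
    rw [← h2, h1, mul_zero]
  have h' : ∀ i j, residueLoop a b c i j = 0 := fun i j => by rw [h]; rfl
  refine ⟨hq _ ?_, hq _ ?_, hq _ ?_⟩
  · simpa [residueLoop] using h' 1 0
  · simpa [residueLoop] using h' 1 1
  · simpa [residueLoop] using h' 0 1

theorem conj_residueLoop_apply_one_one {G G' : LoopMatrix ρ} (hG'G : G' * G = 1) (a b c : W ρ) :
    (G * residueLoop a b c * G') 1 1 = -(G * residueLoop a b c * G') 0 0 := by
  have h : (G * residueLoop a b c * G').trace = 0 := by
    rw [Matrix.trace_mul_comm, ← mul_assoc, hG'G, one_mul, residueLoop, Matrix.trace_smul,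
      Matrix.trace_fin_two_of, neg_add_cancel, smul_zero]
  rw [Matrix.trace_fin_two] at h
  exact eq_neg_of_add_eq_zero_right h

/-- If a conjugate of `residueLoop a b c` is antihermitian and vanishes to second order at
`lam = 1`, then it is zero. -/
theorem residueLoop_eq_zero_of_antihermitian {G G' : LoopMatrix ρ} (hGG' : G * G' = 1)
    (hG'G : G' * G = 1) {a b c : W ρ} (hn : IsNormalized a b c) {S : LoopMatrix ρ}
    (hS : S = G * residueLoop a b c * G') (hanti : S.conjTranspose = -S)
    (h1 : ∀ i j, (S i j).eval 1 = 0) (hd1 : ∀ i j, W.derivOne (S i j) = 0) :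
    residueLoop a b c = 0 := by
  have hdetG : G.det * G'.det = 1 := by rw [← Matrix.det_mul, hGG', Matrix.det_one]
  have hdet : S.det = (residueLoop a b c).det := by
    rw [hS, Matrix.det_mul, Matrix.det_mul, mul_right_comm, hdetG, one_mul]
  have htr : S 1 1 = -S 0 0 := by
    rw [hS]
    exact conj_residueLoop_apply_one_one hG'G a b c
  obtain ⟨hpos, hzero⟩ := eq_zero_of_antihermitian hanti htr
  have hcoeff : ∀ n, S.det.coeff n = -(4 * Real.pi ^ 2) * (a * c - b * b).coeff (n + 2) := by
    intro n
    rw [hdet, det_residueLoop, W.coeff_smul, W.coeff_mono_mul, sub_neg_eq_add]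
  -- Here the normalization enters: `a⁰ = 0` removes the product `a⁰ c⁰`, and `b⁰` imaginary fixes
  -- the sign of `(b⁰)²`.
  have hk : S.det.coeff (-2) = ((-(4 * Real.pi ^ 2 * (b.coeff 0).im ^ 2) : ℝ) : ℂ) := by
    have hb : b.coeff 0 = (b.coeff 0).im * Complex.I := by
      apply Complex.ext <;> simp [hn.re_coeff_b]
    generalize (b.coeff 0).im = y at hb ⊢
    rw [hcoeff, neg_add_cancel, W.coeff_sub, W.coeff_mul_zero hn.nonneg_a hn.nonneg_c,
      W.coeff_mul_zero hn.nonneg_b hn.nonneg_b, hn.coeff_a, hb]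
    push_cast
    linear_combination (-(4 * Real.pi ^ 2) * (-(y : ℂ) ^ 2)) * Complex.I_sq
  obtain ⟨he, hd0⟩ := W.eval_neg_one_eq (d := S.det)
    (fun i hi => by
      rw [hcoeff, W.coeff_sub, W.coeff_mul_eq_zero hn.nonneg_a hn.nonneg_c (by omega),
        W.coeff_mul_eq_zero hn.nonneg_b hn.nonneg_b (by omega), sub_zero, mul_zero])
    (by rw [← Matrix.det_conjTranspose, hanti, Matrix.det_neg]; simp)
    (by rw [hk]; exact Complex.conj_ofReal _)
    -- Each entry of `S` is `o(λ - 1)`, and the determinant is quadratic in the entries.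
    (by
      have h := ((W.tendsto_eval_div (h1 0 0) (hd1 0 0)).mul
        (W.tendsto_eval_div (h1 1 1) (hd1 1 1))).sub
        ((W.tendsto_eval_div (h1 0 1) (hd1 0 1)).mul (W.tendsto_eval_div (h1 1 0) (hd1 1 0)))
      rw [mul_zero, sub_zero] at h
      refine h.congr' ?_
      have hc : Continuous fun u : ℂ => 1 + u := by fun_prop
      have hmem : ∀ᶠ u : ℂ in 𝓝[≠] 0, 1 + u ∈ W.openAnnulus ρ := by
        refine nhdsWithin_le_nhds (hc.continuousAt.eventually_mem ?_)
        rw [add_zero]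
        exact W.isOpen_openAnnulus.mem_nhds W.one_mem_openAnnulus
      filter_upwards [hmem] with u hu
      rw [← eval_det S (W.openAnnulus_subset hu), Matrix.det_fin_two]
      simp only [eval_apply]
      ring)
  -- The determinant at `-1` is nonnegative as a sum of squares and nonpositive as `16` times the
  -- coefficient `hk`.
  have hk0 : S.det.coeff (-2) = 0 := by
    have h2 := hpos (-1) (by simp)
    rw [he, hk] at h2
    have h3 : (0 : ℝ) ≤ 16 * -(4 * Real.pi ^ 2 * (b.coeff 0).im ^ 2) := by
      have h4 : (16 * ((-(4 * Real.pi ^ 2 * (b.coeff 0).im ^ 2) : ℝ) : ℂ)) =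
        ((16 * -(4 * Real.pi ^ 2 * (b.coeff 0).im ^ 2) : ℝ) : ℂ) := by push_cast; ring
      rwa [h4, Complex.ofReal_re] at h2
    have h5 : 0 ≤ 4 * Real.pi ^ 2 * (b.coeff 0).im ^ 2 := by positivity
    rw [hk, show 4 * Real.pi ^ 2 * (b.coeff 0).im ^ 2 = 0 by linarith]
    simp
  have hS0 := hzero (hd0 hk0)
  have hX : residueLoop a b c = G' * S * G := by
    rw [hS]
    simp only [mul_assoc, hG'G, mul_one]
    rw [← mul_assoc, hG'G, one_mul]
  rw [hX, hS0, mul_zero, zero_mul]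

end LoopMatrix

/-! ### Quantitative rigidity by compactness. -/

namespace LoopMatrix

variable {ρ : ℝ} [Fact (1 < ρ)]

/-- The failure of a loop to be antihermitian and to vanish to second order at `lam = 1`. -/
def defect (S : LoopMatrix ρ) : ℝ :=
  ∑ i, ∑ j, (‖(S + S.conjTranspose) i j‖ + ‖(S i j).eval 1‖ + ‖W.derivOne (S i j)‖)

theorem one_mem_closedAnnulus : (1 : ℂ) ∈ W.closedAnnulus ρ :=
  W.mem_closedAnnulus_of_norm_eq_one norm_one

theorem defect_nonneg (S : LoopMatrix ρ) : 0 ≤ defect S := by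
  unfold defect
  positivity

theorem continuous_defect : Continuous (defect : LoopMatrix ρ → ℝ) := by
  have h1 : ∀ i j, Continuous fun S : LoopMatrix ρ => S i j := fun i j =>
    continuous_id.matrix_elem i j
  refine continuous_finsetSum _ fun i _ => continuous_finsetSum _ fun j _ => ?_
  refine ((Continuous.norm ?_).add (Continuous.norm ?_)).add (Continuous.norm ?_)
  · exact (continuous_id.add continuous_id.matrix_conjTranspose).matrix_elem i j
  · exact (W.evalL one_mem_closedAnnulus).continuous.comp (h1 i j)
  · exact W.derivOne.continuous.comp (h1 i j)

theorem defect_eq_zero {S : LoopMatrix ρ} (h : defect S = 0) :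
    S.conjTranspose = -S ∧ (∀ i j, (S i j).eval 1 = 0) ∧ ∀ i j, W.derivOne (S i j) = 0 := by
  have h0 : ∀ i j, ‖(S + S.conjTranspose) i j‖ + ‖(S i j).eval 1‖ + ‖W.derivOne (S i j)‖ = 0 := by
    intro i j
    rw [defect, Finset.sum_eq_zero_iff_of_nonneg (fun i _ => by positivity)] at h
    have h1 := h i (Finset.mem_univ i)
    rw [Finset.sum_eq_zero_iff_of_nonneg (fun i _ => by positivity)] at h1
    exact h1 j (Finset.mem_univ j)
  have h1 : ∀ i j, ‖(S + S.conjTranspose) i j‖ = 0 ∧ ‖(S i j).eval 1‖ = 0 ∧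
      ‖W.derivOne (S i j)‖ = 0 := by
    intro i j
    have h2 := norm_nonneg ((S + S.conjTranspose) i j)
    have h3 := norm_nonneg ((S i j).eval 1)
    have h4 := norm_nonneg (W.derivOne (S i j))
    have h5 := h0 i j
    exact ⟨by linarith, by linarith, by linarith⟩
  refine ⟨?_, fun i j => norm_eq_zero.1 (h1 i j).2.1, fun i j => norm_eq_zero.1 (h1 i j).2.2⟩
  refine eq_neg_of_add_eq_zero_right ?_
  ext1 i j
  exact norm_eq_zero.1 (h1 i j).1

/-- Scalars are real because the adjoint is conjugate-linear; this homogeneity permits rescaling to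
total norm one. -/
theorem defect_smul (r : ℝ) (S : LoopMatrix ρ) : defect ((r : ℂ) • S) = |r| * defect S := by
  have hstar : ∀ f : W ρ, star ((r : ℂ) • f) = (r : ℂ) • star f := fun f => by
    ext i
    rw [W.coeff_star, W.coeff_smul, W.coeff_smul, W.coeff_star, star_mul']
    congr 1
    exact Complex.conj_ofReal r
  have h1 : ∀ i j, ((r : ℂ) • S + ((r : ℂ) • S).conjTranspose) i j =
      (r : ℂ) • (S + S.conjTranspose) i j := fun i j => by
    simp only [Matrix.add_apply, Matrix.conjTranspose_apply, Matrix.smul_apply, hstar, smul_add]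
  simp only [defect, h1, Matrix.smul_apply, W.eval_smul, map_smul, norm_smul, norm_mul,
    Complex.norm_real, Real.norm_eq_abs, Finset.mul_sum, mul_add]

theorem continuous_residueLoop :
    Continuous fun p : W ρ × W ρ × W ρ => residueLoop p.1 p.2.1 p.2.2 := by
  have h : Continuous fun p : W ρ × W ρ × W ρ =>
      (!![-p.2.1, p.2.2; -p.1, p.2.1] : LoopMatrix ρ) := by
    refine continuous_matrix fun i j => ?_
    fin_cases i <;> fin_cases j <;> simp <;> fun_prop
  exact h.const_smul ((2 * Real.pi * Complex.I : ℂ) • (W.mono (-1) : W ρ))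

theorem residueLoop_smul (r : ℂ) (a b c : W ρ) :
    residueLoop (r • a) (r • b) (r • c) = r • residueLoop a b c := by
  rw [residueLoop, residueLoop, smul_comm r]
  congr 1
  ext1 i j
  fin_cases i <;> fin_cases j <;> simp

theorem IsNormalized.smul {a b c : W ρ} (h : IsNormalized a b c) (r : ℝ) :
    IsNormalized ((r : ℂ) • a) ((r : ℂ) • b) ((r : ℂ) • c) where
  nonneg_a i hi := by rw [W.coeff_smul, h.nonneg_a i hi, mul_zero]
  nonneg_b i hi := by rw [W.coeff_smul, h.nonneg_b i hi, mul_zero]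
  nonneg_c i hi := by rw [W.coeff_smul, h.nonneg_c i hi, mul_zero]
  coeff_a := by rw [W.coeff_smul, h.coeff_a, mul_zero]
  re_coeff_b := by rw [W.coeff_smul, Complex.re_ofReal_mul, h.re_coeff_b, mul_zero]

theorem IsNormalized.of_tendsto {ι : Type*} {l : Filter ι} [l.NeBot] {a b c : ι → W ρ}
    {a' b' c' : W ρ} (h : ∀ i, IsNormalized (a i) (b i) (c i)) (ha : Tendsto a l (𝓝 a'))
    (hb : Tendsto b l (𝓝 b')) (hc : Tendsto c l (𝓝 c')) : IsNormalized a' b' c' := by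
  have key : ∀ {f : ι → W ρ} {f' : W ρ} (k : ℤ), Tendsto f l (𝓝 f') →
      Tendsto (fun i => (f i).coeff k) l (𝓝 (f'.coeff k)) := fun k hf =>
    ((W.coeffL k).continuous.tendsto _).comp hf
  have key0 : ∀ {f : ι → W ρ} {f' : W ρ} (k : ℤ), Tendsto f l (𝓝 f') →
      (∀ i, (f i).coeff k = 0) → f'.coeff k = 0 := fun k hf h0 =>
    tendsto_nhds_unique (key k hf) (by simp only [h0]; exact tendsto_const_nhds)
  refine ⟨fun k hk => key0 k ha fun i => (h i).nonneg_a k hk,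
    fun k hk => key0 k hb fun i => (h i).nonneg_b k hk,
    fun k hk => key0 k hc fun i => (h i).nonneg_c k hk, key0 0 ha fun i => (h i).coeff_a, ?_⟩
  refine tendsto_nhds_unique ((Complex.continuous_re.tendsto _).comp (key 0 hb)) ?_
  simp only [Function.comp_def, (h _).re_coeff_b]
  exact tendsto_const_nhds

theorem coeff_residueLoop {a b c : W ρ} (h : IsNormalized a b c) (i j : Fin 2) {k : ℤ}
    (hk : k < -1) : (residueLoop a b c i j).coeff k = 0 := by
  have key : ∀ f : W ρ, (∀ i < 0, f.coeff i = 0) →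
      (((2 * Real.pi * Complex.I : ℂ) • (W.mono (-1) : W ρ)) * f).coeff k = 0 := fun f hf => by
    rw [smul_mul_assoc, W.coeff_smul, W.coeff_mono_mul, hf _ (by omega), mul_zero]
  fin_cases i <;> fin_cases j
  · exact key (-b) fun i hi => by rw [W.coeff_neg, h.nonneg_b i hi, neg_zero]
  · exact key c h.nonneg_c
  · exact key (-a) fun i hi => by rw [W.coeff_neg, h.nonneg_a i hi, neg_zero]
  · exact key b h.nonneg_b

/-- The factor `2πi λ⁻¹` is a unit of `𝓦`, so convergence of the entries passes to `a`, `b`, `c`. -/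
theorem exists_mul_residueLoop_eq : ∃ q : W ρ, ∀ a b c : W ρ,
    q * residueLoop a b c 1 0 = -a ∧ q * residueLoop a b c 1 1 = b ∧
      q * residueLoop a b c 0 1 = c := by
  refine ⟨(2 * Real.pi * Complex.I : ℂ)⁻¹ • W.mono 1, fun a b c => ?_⟩
  have key : ∀ f : W ρ, (2 * Real.pi * Complex.I : ℂ)⁻¹ • W.mono 1 *
      (((2 * Real.pi * Complex.I : ℂ) • (W.mono (-1) : W ρ)) * f) = f := fun f => by
    rw [← mul_assoc, smul_mul_smul_comm, inv_mul_cancel₀ Complex.two_pi_I_ne_zero, one_smul,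
      W.mono_mul_mono, add_neg_cancel, ← W.one_eq_mono, one_mul]
  exact ⟨key (-a), key b, key c⟩

/-- A bounded family of principal parts whose conjugates are asymptotically antihermitian converges
along every ultrafilter. -/
theorem exists_tendsto_residueLoop {ι : Type*} (l : Ultrafilter ι) {G G' : LoopMatrix ρ}
    (hG'G : G' * G = 1) {X : ι → LoopMatrix ρ} {C : ℝ}
    (hX : ∀ n i j, ‖X n i j‖ ≤ C) (hcoeff : ∀ n i j, ∀ k < -1, (X n i j).coeff k = 0)
    (hlim : Tendsto (fun n => G * X n * G' + (G * X n * G').conjTranspose) l (𝓝 0)) (i j : Fin 2) :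
    ∃ y, Tendsto (fun n => X n i j) l (𝓝 y) := by
  set H := G.conjTranspose * G
  set H' := G' * G'.conjTranspose
  set Y : ι → LoopMatrix ρ := fun n =>
    G' * (G * X n * G' + (G * X n * G').conjTranspose) * G with hY
  have hYlim : Tendsto (fun n => Y n i j) l (𝓝 0) := by
    have hc : Continuous fun Z : LoopMatrix ρ => (G' * Z * G) i j :=
      ((continuous_const.matrix_mul continuous_id).matrix_mul continuous_const).matrix_elem i j
    exact (hc.tendsto' 0 0 (by rw [mul_zero, zero_mul, Matrix.zero_apply])).comp hlim
  -- Undoing the conjugation turns the hermitian part of `G X G'`, which tends to zero, into `X + H'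
  -- X* H`.
  have hYX : ∀ n, Y n = X n + H' * (X n).conjTranspose * H := by
    intro n
    calc Y n = (G' * G) * X n * (G' * G) + G' * (G * X n * G').conjTranspose * G := by
          simp only [hY, mul_add, add_mul, mul_assoc]
      _ = _ := by
          rw [hG'G, one_mul, mul_one, Matrix.conjTranspose_mul, Matrix.conjTranspose_mul]
          simp only [H, H', mul_assoc]
  -- As `X` has degrees at least `-1`, `X*` has degrees at most `1`, exactly the source of `hankel`.
  -- Degrees at least `2` of `X` come from `Y → 0` and compact operators; degrees `-1, 0, 1` form a
  -- finite-rank part.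
  have hentry : ∀ n, X n i j = W.restrict (Ici 2) (Y n i j) + W.restrict (Icc (-1) 1) (X n i j) -
      ∑ k, ∑ m, W.hankel (H' i m * H k j) (star (X n k m)) := by
    intro n
    have h1 : X n i j = W.restrict (Ici 2) (X n i j) + W.restrict (Icc (-1) 1) (X n i j) := by
      ext p
      rw [W.coeff_add, W.coeff_restrict, W.coeff_restrict]
      simp only [mem_Ici, mem_Icc]
      by_cases hp : p < -1
      · rw [hcoeff n i j p hp]
        simp
      · by_cases hp' : 2 ≤ p
        · rw [if_pos hp', if_neg (by omega), add_zero]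
        · rw [if_neg hp', if_pos (by omega), zero_add]
    have h2 : X n i j = Y n i j - ∑ k, ∑ m, (H' i m * H k j) * star (X n k m) := by
      rw [hYX n, Matrix.add_apply, add_sub_assoc, left_eq_add, sub_eq_zero, Matrix.mul_apply]
      refine Finset.sum_congr rfl fun k _ => ?_
      rw [Matrix.mul_apply, Finset.sum_mul]
      refine Finset.sum_congr rfl fun m _ => ?_
      rw [Matrix.conjTranspose_apply]
      ring
    have h3 : W.restrict (Ici 2) (X n i j) = W.restrict (Ici 2) (Y n i j) -
        ∑ k, ∑ m, W.hankel (H' i m * H k j) (star (X n k m)) := by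
      conv_lhs => rw [h2]
      simp only [map_sub, map_sum]
      congr 1
      refine Finset.sum_congr rfl fun k _ => Finset.sum_congr rfl fun m _ => ?_
      rw [W.hankel_apply, W.restrict_eq_self (s := Iic 1)]
      intro p hp
      rw [W.coeff_star, hcoeff n k m _ (by simp only [mem_Iic] at hp; omega), star_zero]
    conv_lhs => rw [h1, h3]
    abel
  obtain ⟨y, hy⟩ := W.exists_tendsto_of_isCompactOperator l
    (W.isCompactOperator_restrict_Icc (-1) 1) (fun n => X n i j) fun n => hX n i j
  choose z hz using fun k m : Fin 2 => W.exists_tendsto_of_isCompactOperator l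
    (W.isCompactOperator_hankel (H' i m * H k j)) (fun n => star (X n k m))
    fun n => (W.norm_star' _).trans_le (hX n k m)
  refine ⟨_, ((((W.restrict (Ici 2)).continuous.tendsto 0).comp hYlim).add hy).sub
    (tendsto_finsetSum Finset.univ fun k _ => tendsto_finsetSum Finset.univ fun m _ => hz k m)
      |>.congr fun n => (hentry n).symm⟩

/-- The principal part is controlled by the defect of the conjugated residue. -/
theorem exists_norm_le_mul_defect {G G' : LoopMatrix ρ} (hGG' : G * G' = 1) (hG'G : G' * G = 1) :
    ∃ C : ℝ, 0 ≤ C ∧ ∀ a b c : W ρ, IsNormalized a b c →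
      ‖a‖ + ‖b‖ + ‖c‖ ≤ C * defect (G * residueLoop a b c * G') := by
  by_contra! hcon
  -- Failure of the estimate with constant `n + 1`, rescaled to total norm one, makes the defects
  -- tend to zero.
  have hscaled : ∀ n : ℕ, ∃ a b c : W ρ, IsNormalized a b c ∧ ‖a‖ + ‖b‖ + ‖c‖ = 1 ∧
      defect (G * residueLoop a b c * G') ≤ 1 / ((n : ℝ) + 1) := by
    intro n
    obtain ⟨a, b, c, hn, hlt⟩ := hcon (n + 1) (by positivity)
    set τ := ‖a‖ + ‖b‖ + ‖c‖ with hτ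
    have hτ0 : 0 < τ := lt_of_le_of_lt (mul_nonneg (by positivity) (defect_nonneg _)) hlt
    have habs : |τ⁻¹| = τ⁻¹ := abs_of_pos (inv_pos.2 hτ0)
    refine ⟨_, _, _, hn.smul τ⁻¹, ?_, ?_⟩
    · simp only [norm_smul, Complex.norm_real, Real.norm_eq_abs, habs, ← mul_add]
      rw [← hτ, inv_mul_cancel₀ hτ0.ne']
    · rw [residueLoop_smul, Matrix.mul_smul, Matrix.smul_mul, defect_smul, habs,
        inv_mul_le_iff₀ hτ0, mul_one_div, le_div_iff₀ (by positivity), mul_comm]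
      exact hlt.le
  choose a b c hn hone hdef using hscaled
  set l : Ultrafilter ℕ := Ultrafilter.of atTop
  have hl : (l : Filter ℕ) ≤ atTop := Ultrafilter.of_le atTop
  set X : ℕ → LoopMatrix ρ := fun n => residueLoop (a n) (b n) (c n) with hX
  have hdef0 : Tendsto (fun n => defect (G * X n * G')) l (𝓝 0) :=
    (squeeze_zero (fun n => defect_nonneg _) hdef tendsto_one_div_add_atTop_nhds_zero_nat).mono_left
      hl
  have hbound : ∃ C, ∀ n i j, ‖X n i j‖ ≤ C := by
    refine ⟨‖((2 * Real.pi * Complex.I : ℂ) • (W.mono (-1) : W ρ))‖, fun n i j => ?_⟩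
    have h1 := hone n
    have h2 := norm_nonneg (a n)
    have h3 := norm_nonneg (b n)
    have h4 := norm_nonneg (c n)
    refine (norm_mul_le _ _).trans (mul_le_of_le_one_right (norm_nonneg _) ?_)
    fin_cases i <;> fin_cases j <;> simp <;> linarith
  obtain ⟨C, hC⟩ := hbound
  have hanti : Tendsto (fun n => G * X n * G' + (G * X n * G').conjTranspose) l (𝓝 0) := by
    refine tendsto_pi_nhds.2 fun i => tendsto_pi_nhds.2 fun j => ?_
    refine squeeze_zero_norm (fun n => ?_) hdef0
    rw [defect]
    refine le_trans ?_ (Finset.single_le_sum (fun i _ => by positivity) (Finset.mem_univ i))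
    refine le_trans ?_ (Finset.single_le_sum (fun j _ => by positivity) (Finset.mem_univ j))
    rw [add_assoc]
    exact le_add_of_nonneg_right (by positivity)
  choose Z hZ using exists_tendsto_residueLoop l hG'G hC
    (fun n i j k hk => coeff_residueLoop (hn n) i j hk) hanti
  obtain ⟨q, hq⟩ := exists_mul_residueLoop_eq (ρ := ρ)
  have ha : Tendsto a l (𝓝 (-(q * Z 1 0))) :=
    ((hZ 1 0).const_mul q).neg.congr fun n => by rw [(hq _ _ _).1, neg_neg]
  have hb : Tendsto b l (𝓝 (q * Z 1 1)) :=
    ((hZ 1 1).const_mul q).congr fun n => (hq _ _ _).2.1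
  have hc : Tendsto c l (𝓝 (q * Z 0 1)) :=
    ((hZ 0 1).const_mul q).congr fun n => (hq _ _ _).2.2
  have hn' := IsNormalized.of_tendsto hn ha hb hc
  have hone' := tendsto_nhds_unique ((ha.norm.add hb.norm).add hc.norm)
    (by simp only [hone]; exact tendsto_const_nhds)
  have hXlim := (continuous_residueLoop.tendsto _).comp (ha.prodMk_nhds (hb.prodMk_nhds hc))
  have hcont : Continuous fun X : LoopMatrix ρ => defect (G * X * G') :=
    continuous_defect.comp ((continuous_const.matrix_mul continuous_id).matrix_mul continuous_const)
  -- The limit has total norm one by norm convergence, yet zero defect, so rigidity gives the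
  -- contradiction.
  obtain ⟨h1, h2, h3⟩ := defect_eq_zero
    (tendsto_nhds_unique ((hcont.tendsto _).comp hXlim) hdef0)
  obtain ⟨h4, h5, h6⟩ := residueLoop_eq_zero
    (residueLoop_eq_zero_of_antihermitian hGG' hG'G hn' rfl h1 h2 h3)
  rw [h4, h5, h6] at hone'
  simp at hone'

end LoopMatrix

/-! ### Trace-free parts of unitary loops, and the residue of the catenoid. -/

open scoped Matrix.Norms.Operator

namespace LoopMatrix

variable {ρ : ℝ} [Fact (1 < ρ)]

theorem norm_apply_le (A : LoopMatrix ρ) (i j : Fin 2) : ‖A i j‖ ≤ ‖A‖ := by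
  rw [Matrix.linfty_opNorm_def]
  have h1 : ‖A i j‖₊ ≤ ∑ j, ‖A i j‖₊ :=
    Finset.single_le_sum (f := fun j => ‖A i j‖₊) (fun _ _ => zero_le) (Finset.mem_univ j)
  exact_mod_cast h1.trans (Finset.le_sup (f := fun i => ∑ j, ‖A i j‖₊) (Finset.mem_univ i))

/-- The trace-free part of a loop matrix. -/
def traceFree (A : LoopMatrix ρ) : LoopMatrix ρ :=
  !![(1 / 2 : ℂ) • (A 0 0 - A 1 1), A 0 1; A 1 0, (1 / 2 : ℂ) • (A 1 1 - A 0 0)]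

theorem traceFree_sub (A B : LoopMatrix ρ) : traceFree (A - B) = traceFree A - traceFree B := by
  ext1 i j
  fin_cases i <;> fin_cases j <;> simp [traceFree] <;> module

/-- Trace-free parts ignore scalars, so the two cases `M(1) = 1` and `M(1) = -1` need no separate
treatment. -/
theorem traceFree_one : traceFree (1 : LoopMatrix ρ) = 0 := by
  ext1 i j
  fin_cases i <;> fin_cases j <;> simp [traceFree]

theorem traceFree_eq_self {A : LoopMatrix ρ} (h : A 1 1 = -A 0 0) : traceFree A = A := by
  ext1 i j
  fin_cases i <;> fin_cases j <;> simp [traceFree, h] <;> module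

theorem norm_traceFree_apply_le (A : LoopMatrix ρ) (i j : Fin 2) : ‖traceFree A i j‖ ≤ ‖A‖ := by
  have h := norm_apply_le A
  have key : ∀ x y : W ρ, ‖x‖ ≤ ‖A‖ → ‖y‖ ≤ ‖A‖ → ‖(1 / 2 : ℂ) • (x - y)‖ ≤ ‖A‖ := by
    intro x y hx hy
    rw [norm_smul]
    have := norm_sub_le x y
    norm_num
    linarith
  fin_cases i <;> fin_cases j
  · exact key _ _ (h 0 0) (h 1 1)
  · exact h 0 1
  · exact h 1 0
  · exact key _ _ (h 1 1) (h 0 0)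

theorem exists_defect_traceFree_le :
    ∃ C : ℝ, 0 ≤ C ∧ ∀ A : LoopMatrix ρ, defect (traceFree A) ≤ C * ‖A‖ := by
  refine ⟨∑ _i : Fin 2, ∑ _j : Fin 2, (2 + 1 + ‖(W.derivOne : W ρ →L[ℂ] ℂ)‖), by positivity,
    fun A => ?_⟩
  rw [defect, Finset.sum_mul]
  refine Finset.sum_le_sum fun i _ => ?_
  rw [Finset.sum_mul]
  refine Finset.sum_le_sum fun j _ => ?_
  have h1 := norm_traceFree_apply_le A
  have h2 : ‖(traceFree A + (traceFree A).conjTranspose) i j‖ ≤ 2 * ‖A‖ := by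
    rw [Matrix.add_apply, Matrix.conjTranspose_apply]
    have h3 := norm_add_le (traceFree A i j) (star (traceFree A j i))
    rw [W.norm_star'] at h3
    linarith [h1 i j, h1 j i]
  have h3 := (W.norm_eval_le (traceFree A i j) one_mem_closedAnnulus).trans (h1 i j)
  have h4 : ‖W.derivOne (traceFree A i j)‖ ≤ ‖(W.derivOne : W ρ →L[ℂ] ℂ)‖ * ‖A‖ :=
    (W.derivOne.le_opNorm _).trans (mul_le_mul_of_nonneg_left (h1 i j) (norm_nonneg _))
  linarith

theorem eval_inv {A : LoopMatrix ρ} (hA : A.det = 1) {lam : ℂ} (h : lam ∈ W.closedAnnulus ρ) :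
    (A.eval lam)⁻¹ = LoopMatrix.eval A.adjugate lam := by
  rw [Matrix.inv_def, eval_det A h, hA, W.eval_one, Ring.inverse_one, one_smul,
    eval_eq_mapMatrix _ h, eval_eq_mapMatrix _ h, RingHom.map_adjugate]

/-- The defect does not change if one subtracts the trace-free part of a unitary loop which is
`± 1` to second order at `lam = 1`. -/
theorem defect_sub_traceFree {M S : LoopMatrix ρ}
    (hU : ∀ lam : ℂ, ‖lam‖ = 1 → M.eval lam ∈ Matrix.specialUnitaryGroup (Fin 2) ℂ)
    (h1 : M.eval 1 = 1 ∨ M.eval 1 = -1) (hd : ∀ i j, W.derivOne (M i j) = 0) :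
    defect (S - traceFree M) = defect S := by
  -- For `2 × 2` matrices this says that `M + M*` is the scalar `tr M`, which makes the trace-free
  -- part antihermitian.
  have hadj : M.conjTranspose = M.adjugate := by
    refine ext_eval fun lam hl => ?_
    have hl' := W.mem_closedAnnulus_of_norm_eq_one (ρ := ρ) hl
    obtain ⟨h2, h3⟩ := Matrix.mem_specialUnitaryGroup_iff.1 (hU lam hl)
    have h4 : LoopMatrix.eval M.conjTranspose lam = star (M.eval lam) := by
      ext1 i j
      exact W.eval_star _ hl
    have h5 : LoopMatrix.eval M.adjugate lam = (M.eval lam).adjugate := by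
      rw [eval_eq_mapMatrix _ hl', eval_eq_mapMatrix _ hl', RingHom.map_adjugate]
    rw [h4, h5]
    calc star (M.eval lam) = (M.eval lam).adjugate * M.eval lam * star (M.eval lam) := by
          rw [Matrix.adjugate_mul, h3, one_smul, one_mul]
      _ = (M.eval lam).adjugate := by
          rw [mul_assoc, Matrix.mem_unitaryGroup_iff.1 h2, mul_one]
  rw [Matrix.adjugate_fin_two] at hadj
  have hstar : ∀ i j, star (M i j) = !![M 1 1, -M 0 1; -M 1 0, M 0 0] j i := fun i j => by
    rw [← hadj, Matrix.conjTranspose_apply]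
  have hsmul : ∀ f : W ρ, star ((2⁻¹ : ℂ) • f) = (2⁻¹ : ℂ) • star f := fun f => by
    ext i
    rw [W.coeff_star, W.coeff_smul, W.coeff_smul, W.coeff_star, star_mul']
    simp
  have hT : ∀ i j, star (traceFree M i j) = -traceFree M j i := by
    intro i j
    fin_cases i <;> fin_cases j <;> simp [traceFree, hsmul, hstar] <;> module
  have he : ∀ i j, (traceFree M i j).eval 1 = 0 := by
    have h2 : (M 0 0).eval 1 = (M 1 1).eval 1 ∧ (M 0 1).eval 1 = 0 ∧ (M 1 0).eval 1 = 0 := by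
      simp only [← eval_apply]
      rcases h1 with h | h <;> rw [h] <;> simp
    have h3 : ∀ f g : W ρ, f.eval 1 = g.eval 1 → ((1 / 2 : ℂ) • (f - g)).eval 1 = 0 := by
      intro f g hfg
      rw [W.eval_smul, ← W.evalHom_apply one_mem_closedAnnulus, map_sub, W.evalHom_apply,
        W.evalHom_apply, hfg, sub_self, mul_zero]
    intro i j
    fin_cases i <;> fin_cases j
    · exact h3 _ _ h2.1
    · exact h2.2.1
    · exact h2.2.2
    · exact h3 _ _ h2.1.symm
  have hd' : ∀ i j, W.derivOne (traceFree M i j) = 0 := by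
    intro i j
    fin_cases i <;> fin_cases j <;> simp [traceFree, hd]
  refine Finset.sum_congr rfl fun i _ => Finset.sum_congr rfl fun j _ => ?_
  have e1 : (S - traceFree M + (S - traceFree M).conjTranspose) i j =
      (S + S.conjTranspose) i j := by
    simp only [Matrix.add_apply, Matrix.conjTranspose_apply, Matrix.sub_apply, star_sub, hT]
    abel
  have e2 : ((S - traceFree M) i j).eval 1 = (S i j).eval 1 := by
    rw [Matrix.sub_apply, ← W.evalHom_apply one_mem_closedAnnulus, map_sub, W.evalHom_apply,
      W.evalHom_apply, he, sub_zero]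
  have e3 : W.derivOne ((S - traceFree M) i j) = W.derivOne (S i j) := by
    rw [Matrix.sub_apply, map_sub, hd', sub_zero]
  rw [e1, e2, e3]

/-- The catenoid potential. -/
def catenoid : LoopMatrix ρ := !![0, 0; 1, 0]

theorem catenoid_mul_catenoid : (catenoid : LoopMatrix ρ) * catenoid = 0 := by
  ext1 i j
  fin_cases i <;> fin_cases j <;> simp [catenoid, Matrix.mul_apply]

/-- The matrix `(0, lam⁻¹ f; 0, 0)`. -/
def poleLoop (f : W ρ) : LoopMatrix ρ := !![0, W.mono (-1) * f; 0, 0]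

theorem poleLoop_zero : poleLoop (0 : W ρ) = 0 := by
  ext1 i j
  fin_cases i <;> fin_cases j <;> simp [poleLoop]

theorem exists_norm_poleLoop_le : ∃ C : ℝ, 0 ≤ C ∧ ∀ f : W ρ, ‖poleLoop f‖ ≤ C * ‖f‖ := by
  refine ⟨‖(W.mono (-1) : W ρ)‖, norm_nonneg _, fun f => ?_⟩
  rw [Matrix.linfty_opNorm_def]
  have h : (Finset.univ.sup fun i => ∑ j, ‖poleLoop f i j‖₊) ≤ ‖W.mono (-1) * f‖₊ := by
    refine Finset.sup_le fun i _ => ?_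
    fin_cases i <;> simp [poleLoop]
  exact (NNReal.coe_le_coe.2 h).trans (norm_mul_le _ _)

/-- With `N` strictly lower and the polar coefficients strictly upper triangular, `N A N` moves `a`
to the lower left corner, the commutator puts `b` on the diagonal, and `c` stays in place. -/
theorem smul_residueTerm_poleLoop (a b c : W ρ) :
    (2 * Real.pi * Complex.I : ℂ) • residueTerm catenoid (poleLoop a) (poleLoop b) (poleLoop c) =
      residueLoop a b c := by
  ext1 i j
  fin_cases i <;> fin_cases j <;>
    simp [residueTerm, residueLoop, catenoid, poleLoop]

end LoopMatrix

/-! ### From potentials and solutions to equations between loops. -/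

theorem isOpen_puncturedDisk (R : ℝ) : IsOpen (puncturedDisk R) :=
  isOpen_ne.inter (isOpen_lt continuous_norm continuous_const)

theorem isOpen_cover (R : ℝ) : IsOpen (cover R) :=
  (isOpen_puncturedDisk R).preimage Complex.continuous_exp

theorem mem_cover_iff {R : ℝ} {w : ℂ} : w ∈ cover R ↔ Real.exp w.re < R := by
  rw [cover, mem_ofPred_eq, puncturedDisk, mem_ofPred_eq, Complex.norm_exp]
  simp

variable {ρ : ℝ} [Fact (1 < ρ)]

open LoopMatrix

theorem hasDerivAt_loopMatrix {𝕜 : Type*} [NontriviallyNormedField 𝕜] [NormedAlgebra 𝕜 ℂ]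
    [NormedSpace 𝕜 (W ρ)] {F : 𝕜 → LoopMatrix ρ} {F' : LoopMatrix ρ} {x : 𝕜}
    (h : ∀ i j, HasDerivAt (fun y => F y i j) (F' i j) x) : HasDerivAt F F' x :=
  hasDerivAt_pi.2 fun i => hasDerivAt_pi.2 fun j => h i j

theorem IsHolomorphicOn.differentiableOn {U : Set ℂ} (hU : IsOpen U) {A : ℂ → LoopMatrix ρ}
    (hA : IsHolomorphicOn U A) : DifferentiableOn ℂ A U := fun z hz =>
  (hasDerivAt_loopMatrix (F' := fun i j => deriv (fun z => A z i j) z) fun i j =>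
    ((hA i j).differentiableAt (hU.mem_nhds hz)).hasDerivAt).differentiableAt.differentiableWithinAt

/-- A curve in `𝓦` is differentiable with the derivative computed pointwise on the circle. -/
theorem W.hasDerivAt_of_eval {F : ℝ → W ρ} {d : W ρ} {s : ℝ} (hF : DifferentiableAt ℝ F s)
    (h : ∀ lam : ℂ, ‖lam‖ = 1 → HasDerivAt (fun s => (F s).eval lam) (d.eval lam) s) :
    HasDerivAt F d s := by
  have h1 := hF.hasDerivAt
  refine h1.congr_deriv (W.ext_eval fun lam hl => ?_)
  have h2 := ((W.evalL (W.mem_closedAnnulus_of_norm_eq_one (ρ := ρ) hl)).restrictScalars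
    ℝ).hasFDerivAt.comp_hasDerivAt s h1
  exact h2.unique (h lam hl)

theorem LoopMatrix.eval_smul (k : ℂ) (A : LoopMatrix ρ) (lam : ℂ) :
    LoopMatrix.eval (k • A) lam = k • A.eval lam := by
  ext1 i j
  exact W.eval_smul k (A i j) lam

/-- The differential equation, along a vertical line, as an equation between loops. -/
theorem IsSolution.hasDerivAt {R ε t : ℝ} {ξ : ℂ → LoopMatrix ρ} {Φ : ℝ → ℂ → LoopMatrix ρ}
    (hΦC1 : IsC1Family ε (cover R) Φ) (ht : t ∈ Ioo (-ε) ε) (hΦ : IsSolution R ξ (Φ t)) {w₀ : ℂ}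
    (hw₀ : w₀ ∈ cover R) (s : ℝ) :
    HasDerivAt (fun s : ℝ => Φ t (w₀ + s * Complex.I))
      (Φ t (w₀ + s * Complex.I) * ((Complex.I * circlePath w₀ s) • ξ (circlePath w₀ s))) s := by
  have hmem : w₀ + s * Complex.I ∈ cover R := by
    rw [mem_cover_iff] at hw₀ ⊢
    simpa using hw₀
  have hline : HasDerivAt (fun s : ℝ => w₀ + s * Complex.I) (1 * Complex.I) s :=
    (((hasDerivAt_id s).ofReal_comp).mul_const Complex.I).const_add w₀
  -- The `C¹` hypothesis supplies differentiability in the norm of `𝓦`; the equation, known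
  -- pointwise in `λ`, only identifies the derivative.
  refine hasDerivAt_loopMatrix fun i j => W.hasDerivAt_of_eval ?_ fun lam hl => ?_
  · have h1 : DifferentiableAt ℝ (fun p : ℝ × ℂ => Φ p.1 p.2 i j) (t, w₀ + s * Complex.I) :=
      ((hΦC1 i j).contDiffAt ((isOpen_Ioo.prod (isOpen_cover R)).mem_nhds ⟨ht, hmem⟩)
        ).differentiableAt one_ne_zero
    exact h1.comp s ((differentiableAt_const t).prodMk hline.differentiableAt)
  · have hl' := W.mem_closedAnnulus_of_norm_eq_one (ρ := ρ) hl
    have h1 := (hΦ _ hmem lam hl i j).scomp s hline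
    refine h1.congr_deriv ?_
    rw [← LoopMatrix.eval_apply, LoopMatrix.eval_mul _ _ hl', LoopMatrix.eval_smul,
      Matrix.mul_smul, Matrix.smul_apply, Matrix.smul_apply, smul_smul, one_mul]
    rfl

theorem IsC1Family.continuousAt {ε t : ℝ} {U : Set ℂ} (hU : IsOpen U) {A : ℝ → ℂ → LoopMatrix ρ}
    (hA : IsC1Family ε U A) (ht : t ∈ Ioo (-ε) ε) {z : ℂ} (hz : z ∈ U) :
    ContinuousAt (fun p : ℝ × ℂ => A p.1 p.2) (t, z) :=
  continuousAt_pi.2 fun i => continuousAt_pi.2 fun j =>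
    (hA i j).continuousOn.continuousAt ((isOpen_Ioo.prod hU).mem_nhds ⟨ht, hz⟩)

/-- Joint continuity together with compactness of `K` makes the closeness uniform on `K`. -/
theorem IsC1Family.eventually_norm_sub_le {ε κ : ℝ} {U K : Set ℂ} (hU : IsOpen U) (hε : 0 < ε)
    (hK : IsCompact K) (hKU : K ⊆ U) {A : ℝ → ℂ → LoopMatrix ρ} (hA : IsC1Family ε U A)
    (hκ : 0 < κ) : ∀ᶠ t in 𝓝 (0 : ℝ), ∀ z ∈ K, ‖A t z - A 0 z‖ ≤ κ := by
  refine hK.eventually_forall_of_forall_eventually (P := fun t z => ‖A t z - A 0 z‖ ≤ κ)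
    fun z hz => ?_
  have h0 : (0 : ℝ) ∈ Ioo (-ε) ε := ⟨neg_lt_zero.2 hε, hε⟩
  have h1 := hA.continuousAt hU h0 (hKU hz)
  have h2 : ContinuousAt (fun p : ℝ × ℂ => A 0 p.2) (0, z) :=
    ContinuousAt.comp' (f := fun p : ℝ × ℂ => ((0 : ℝ), p.2)) (x := ((0 : ℝ), z)) h1
      (continuousAt_const.prodMk continuousAt_snd)
  have h3 := (h1.sub h2).norm
  have h4 : ∀ᶠ p : ℝ × ℂ in 𝓝 (0, z), ‖A p.1 p.2 - A 0 p.2‖ < κ :=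
    h3.eventually_lt continuousAt_const (by simpa using hκ)
  exact h4.mono fun p hp => hp.le

/-- The principal part as an equation between loops. -/
theorem HasPrincipalPart.exists_eq {R : ℝ} {ξ : ℂ → LoopMatrix ρ} {a b c : W ρ}
    (h : HasPrincipalPart R ξ a b c) :
    ∃ Ξ : ℂ → LoopMatrix ρ, IsHolomorphicOn (Metric.ball 0 R) Ξ ∧ ∀ z ∈ puncturedDisk R,
      ξ z = (z ^ 3)⁻¹ • poleLoop a + (z ^ 2)⁻¹ • poleLoop b + z⁻¹ • poleLoop c + Ξ z := by
  obtain ⟨Ξ, hΞ, hξ⟩ := h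
  refine ⟨Ξ, hΞ, fun z hz => LoopMatrix.ext_eval fun lam hl => ?_⟩
  have hl' := W.mem_closedAnnulus_of_norm_eq_one (ρ := ρ) hl
  rw [hξ z hz lam hl]
  have hadd : ∀ A B : LoopMatrix ρ, LoopMatrix.eval (A + B) lam = A.eval lam + B.eval lam :=
    fun A B => by
      rw [LoopMatrix.eval_eq_mapMatrix _ hl', map_add]
      rfl
  have hpole : ∀ f : W ρ, LoopMatrix.eval (poleLoop f) lam = f.eval lam • !![0, lam⁻¹; 0, 0] := by
    intro f
    have h0 : (0 : W ρ).eval lam = 0 := (W.evalHom hl').map_zero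
    ext1 i j
    fin_cases i <;> fin_cases j <;>
      simp [LoopMatrix.eval_apply, poleLoop, h0, W.eval_mul _ _ hl', W.eval_mono, mul_comm]
  rw [hadd, hadd, hadd, LoopMatrix.eval_smul, LoopMatrix.eval_smul, LoopMatrix.eval_smul, hpole,
    hpole, hpole, smul_smul, smul_smul, smul_smul, ← add_smul, ← add_smul]
  congr 2
  ring

/-- A single Fourier coefficient is a scalar function with a pole of order at most three, so the
Cauchy estimates apply with `κ = 0`. -/
theorem coeff_eq_zero_of_principalPart {R : ℝ} (hR : 0 < R) {f h : ℂ → W ρ} {a b c : W ρ} {k : ℤ}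
    (hh : DifferentiableOn ℂ h (Metric.ball 0 R))
    (hf : ∀ z ∈ puncturedDisk R,
      f z = (z ^ 3)⁻¹ • a + (z ^ 2)⁻¹ • b + z⁻¹ • c + h z)
    (hk : ∀ z ∈ puncturedDisk R, (f z).coeff k = 0) :
    a.coeff k = 0 ∧ b.coeff k = 0 ∧ c.coeff k = 0 := by
  have hmem : ∀ z : ℂ, ‖z‖ = R / 2 → z ∈ puncturedDisk R := fun z hz =>
    ⟨fun h0 => by rw [h0, norm_zero] at hz; linarith, by rw [hz]; linarith⟩
  obtain ⟨h1, h2, h3, -⟩ := norm_principalPart_le (f := fun z => (f z).coeff k)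
    (h := fun z => (h z).coeff k) (a := a.coeff k) (b := b.coeff k) (c := c.coeff k)
    (r := R / 2) (R := R) (κ := 0) (by linarith) (by linarith)
    ((W.coeffL k).differentiable.comp_differentiableOn hh)
    (fun z hz => by rw [hf z (hmem z hz)]; simp)
    (fun z hz => by rw [hk z (hmem z hz), norm_zero])
  simp only [mul_zero, norm_le_zero_iff] at h1 h2 h3
  exact ⟨h1, h2, h3⟩

/-- The degree condition on the upper right entry passes to its polar coefficients; the factor `λ⁻¹`
shifts the threshold from `-1` to `0`. -/
theorem isNormalized_of_principalPart {R : ℝ} (hR : 0 < R) {ξ Ξ : ℂ → LoopMatrix ρ} {a b c : W ρ}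
    (hξ : IsDPWPotential (puncturedDisk R) ξ) (hΞ : IsHolomorphicOn (Metric.ball 0 R) Ξ)
    (hpole : ∀ z ∈ puncturedDisk R,
      ξ z = (z ^ 3)⁻¹ • poleLoop a + (z ^ 2)⁻¹ • poleLoop b + z⁻¹ • poleLoop c + Ξ z)
    (ha : a.coeff 0 = 0) (hb : (b.coeff 0).re = 0) : IsNormalized a b c := by
  have key : ∀ i < 0, a.coeff i = 0 ∧ b.coeff i = 0 ∧ c.coeff i = 0 := by
    intro i hi
    have h := coeff_eq_zero_of_principalPart (f := fun z => ξ z 0 1) (a := W.mono (-1) * a)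
      (b := W.mono (-1) * b) (c := W.mono (-1) * c) (k := i - 1) hR (hΞ 0 1)
      (fun z hz => by rw [hpole z hz]; rfl)
      (fun z hz => hξ.beta_nonneg z hz _ (by omega))
    simpa only [W.coeff_mono_mul, sub_neg_eq_add, sub_add_cancel] using h
  exact ⟨fun i hi => (key i hi).1, fun i hi => (key i hi).2.1, fun i hi => (key i hi).2.2, ha, hb⟩

/-- Translation by `2 π i` as a deck transformation. -/
def deckTranslation (R : ℝ) : cover R ≃ₜ cover R where
  toFun w := ⟨w + 2 * Real.pi * Complex.I, by
    have := mem_cover_iff.1 w.2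
    exact mem_cover_iff.2 (by simpa using this)⟩
  invFun w := ⟨w - 2 * Real.pi * Complex.I, by
    have := mem_cover_iff.1 w.2
    exact mem_cover_iff.2 (by simpa using this)⟩
  left_inv w := by ext; simp
  right_inv w := by ext; simp
  continuous_toFun := by fun_prop
  continuous_invFun := by fun_prop

theorem isDeck_deckTranslation (R : ℝ) : IsDeck R (deckTranslation R) := fun w =>
  Complex.exp_periodic w

/-- The monodromy along the generator of the fundamental group, as a loop. -/
theorem monodromy_deckTranslation {R : ℝ} {Φ : ℂ → LoopMatrix ρ}
    (hSL : ∀ w ∈ cover R, (Φ w).IsSL) (w : cover R) {lam : ℂ} (h : lam ∈ W.closedAnnulus ρ) :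
    monodromy Φ (deckTranslation R) w lam =
      LoopMatrix.eval (Φ (w + (2 * Real.pi : ℝ) * Complex.I) * (Φ w).adjugate) lam := by
  rw [LoopMatrix.eval_mul _ _ h, ← LoopMatrix.eval_inv (hSL w w.2).det_eq_one h]
  simp [monodromy, deckTranslation]

theorem SolvesMonodromyProblem.of_deckTranslation {R : ℝ} {Φ : ℂ → LoopMatrix ρ}
    (hΦ : SolvesMonodromyProblem R Φ) (hSL : ∀ w ∈ cover R, (Φ w).IsSL) {w : ℂ} (hw : w ∈ cover R)
    {M : LoopMatrix ρ} (hM : M = Φ (w + (2 * Real.pi : ℝ) * Complex.I) * (Φ w).adjugate) :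
    (∀ lam : ℂ, ‖lam‖ = 1 → M.eval lam ∈ Matrix.specialUnitaryGroup (Fin 2) ℂ) ∧
      (M.eval 1 = 1 ∨ M.eval 1 = -1) ∧ ∀ i j, W.derivOne (M i j) = 0 := by
  obtain ⟨h1, h2, h3⟩ := hΦ _ (isDeck_deckTranslation R) ⟨w, hw⟩
  have key : ∀ lam ∈ W.closedAnnulus ρ,
      monodromy Φ (deckTranslation R) ⟨w, hw⟩ lam = M.eval lam := fun lam hl => by
    rw [monodromy_deckTranslation hSL _ hl, hM]
  refine ⟨fun lam hl => ?_, ?_, fun i j => ?_⟩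
  · rw [← key lam (W.mem_closedAnnulus_of_norm_eq_one hl)]
    exact h1 lam hl
  · rw [← key 1 one_mem_closedAnnulus]
    exact h2
  -- The monodromy and the loop `M` agree on the open annulus, hence have the same derivative in
  -- complex `λ`, not only along the circle.
  · refine (W.hasDerivAt_eval_one (M i j)).unique ((h3 i j).congr_of_eventuallyEq ?_)
    filter_upwards [W.isOpen_openAnnulus.mem_nhds (W.one_mem_openAnnulus (ρ := ρ))] with lam hl
    rw [key lam (W.openAnnulus_subset hl)]
    rfl

theorem eq_catenoid_of_eval {A : LoopMatrix ρ}
    (h : ∀ lam : ℂ, ‖lam‖ = 1 → A.eval lam = !![0, 0; 1, 0]) : A = catenoid := by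
  refine LoopMatrix.ext_eval fun lam hl => ?_
  have h0 : (0 : W ρ).eval lam = 0 :=
    (W.evalHom (W.mem_closedAnnulus_of_norm_eq_one (ρ := ρ) hl)).map_zero
  rw [h lam hl]
  ext1 i j
  fin_cases i <;> fin_cases j <;> simp [LoopMatrix.eval_apply, catenoid, h0, W.eval_one]

/-- A solution of the differential equation with the catenoid potential. -/
theorem eq_mul_one_add_smul_catenoid {φ : ℝ → LoopMatrix ρ} {w₀ : ℂ}
    (h : ∀ s, HasDerivAt φ (φ s * ((Complex.I * circlePath w₀ s) • catenoid)) s) (s : ℝ) :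
    φ s = φ 0 * (1 - circlePath w₀ 0 • catenoid) * (1 + circlePath w₀ s • catenoid) := by
  have hder : ∀ s, HasDerivAt (fun s => φ s * (1 - circlePath w₀ s • catenoid)) 0 s := by
    intro s
    refine ((h s).mul
      (((hasDerivAt_circlePath w₀ s).smul_const catenoid).const_sub 1)).congr_deriv ?_
    simp [mul_sub, mul_assoc, catenoid_mul_catenoid]
  have hconst := is_const_of_deriv_eq_zero (fun s => (hder s).differentiableAt)
    (fun s => (hder s).deriv) 0 s
  rw [hconst, mul_assoc, one_sub_smul_mul_one_add_smul catenoid_mul_catenoid, mul_one]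

/-- Completeness for the uniform structure of the operator norm. -/
theorem LoopMatrix.completeSpace :
    @CompleteSpace (LoopMatrix ρ) PseudoMetricSpace.toUniformSpace :=
  inferInstanceAs (CompleteSpace (Fin 2 → Fin 2 → W ρ))

/-! ### Comparison of the two bounds. -/

/-- For small `t ≠ 0` the principal part of the potential vanishes. -/
theorem eventually_principalPart_eq_zero {R ε : ℝ} (hR : 0 < R) (hε : 0 < ε)
    {ξ Φ : ℝ → ℂ → LoopMatrix ρ} {w₀ : ℂ} (hw₀ : w₀ ∈ cover R) {a b c : ℝ → W ρ}
    (hξC1 : IsC1Family ε (puncturedDisk R) ξ)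
    (hξ : ∀ t ∈ Ioo (-ε) ε, IsDPWPotential (puncturedDisk R) (ξ t))
    (hΦC1 : IsC1Family ε (cover R) Φ) (hΦSL : ∀ t ∈ Ioo (-ε) ε, ∀ w ∈ cover R, (Φ t w).IsSL)
    (hΦ : ∀ t ∈ Ioo (-ε) ε, IsSolution R (ξ t) (Φ t))
    (hcatenoid : ∀ z ∈ puncturedDisk R, ξ 0 z = catenoid)
    (hpole : ∀ t ∈ Ioo (-ε) ε, t ≠ 0 → HasPrincipalPart R (ξ t) (a t) (b t) (c t))
    (hmonodromy : ∀ t ∈ Ioo (-ε) ε, t ≠ 0 → SolvesMonodromyProblem R (Φ t))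
    (ha : ∀ t ∈ Ioo (-ε) ε, t ≠ 0 → (a t).coeff 0 = 0)
    (hb : ∀ t ∈ Ioo (-ε) ε, t ≠ 0 → ((b t).coeff 0).re = 0) :
    ∀ᶠ t in 𝓝 (0 : ℝ), t ≠ 0 → a t = 0 ∧ b t = 0 ∧ c t = 0 := by
  have h0mem : (0 : ℝ) ∈ Ioo (-ε) ε := ⟨neg_lt_zero.2 hε, hε⟩
  have hline : ∀ s : ℝ, w₀ + s * Complex.I ∈ cover R := fun s => by
    rw [mem_cover_iff] at hw₀ ⊢
    simpa using hw₀
  have hpath : ∀ s, circlePath w₀ s ∈ puncturedDisk R := hline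
  obtain ⟨r, hr, hrR⟩ := exists_between (mem_cover_iff.1 hw₀)
  have hr0 : 0 < r := (Real.exp_pos _).trans hr
  set N : LoopMatrix ρ := catenoid
  -- The constant factor for which `Φ 0 = G (1 + z N)` along the path.
  set G : LoopMatrix ρ := Φ 0 w₀ * (1 - circlePath w₀ 0 • N) with hG
  set G' : LoopMatrix ρ := (1 + circlePath w₀ 0 • N) * (Φ 0 w₀).adjugate with hG'
  have hdet : ∀ t ∈ Ioo (-ε) ε, ∀ w ∈ cover R, (Φ t w).det = 1 := fun t ht w hw =>
    (hΦSL t ht w hw).det_eq_one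
  have hGG' : G * G' = 1 := by
    rw [hG, hG', mul_assoc, ← mul_assoc (1 - circlePath w₀ 0 • N),
      one_sub_smul_mul_one_add_smul catenoid_mul_catenoid, one_mul, Matrix.mul_adjugate,
      hdet 0 h0mem w₀ hw₀, one_smul]
  have hG'G : G' * G = 1 := by
    rw [hG, hG', mul_assoc, ← mul_assoc (Φ 0 w₀).adjugate, Matrix.adjugate_mul,
      hdet 0 h0mem w₀ hw₀, one_smul, one_mul, one_add_smul_mul_one_sub_smul catenoid_mul_catenoid]
  have hφ0 : ∀ s : ℝ, Φ 0 (w₀ + s * Complex.I) = G * (1 + circlePath w₀ s • N) := by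
    intro s
    have h := eq_mul_one_add_smul_catenoid (φ := fun s : ℝ => Φ 0 (w₀ + s * Complex.I))
      (w₀ := w₀) (fun s => by
        have h1 := (hΦ 0 h0mem).hasDerivAt hΦC1 h0mem hw₀ s
        rwa [hcatenoid _ (hpath s)] at h1) s
    simpa using h
  obtain ⟨C₁, hC₁, hlower⟩ := exists_norm_le_mul_defect hGG' hG'G
  obtain ⟨C₂, hC₂, hdefect⟩ := exists_defect_traceFree_le (ρ := ρ)
  obtain ⟨C₃, hC₃, hpoleLoop⟩ := exists_norm_poleLoop_le (ρ := ρ)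
  -- Chosen so that `C₁ C₂ C₃ η ≤ 1 / 2`, which closes the loop of estimates at `h3`.
  set η : ℝ := (2 * (C₁ * C₂ * C₃ + 1))⁻¹ with hη
  have := LoopMatrix.completeSpace (ρ := ρ)
  obtain ⟨κ, hκ, hexp⟩ := exists_norm_monodromy_sub_le (N := N) catenoid_mul_catenoid hGG' hr hrR
    (η := η) (by positivity)
  have hsphere : Metric.sphere (0 : ℂ) r ⊆ puncturedDisk R := by
    intro z hz
    have hz' : ‖z‖ = r := by simpa using hz
    exact ⟨fun h => by rw [h, norm_zero] at hz'; exact hr0.ne hz', hz' ▸ hrR⟩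
  have hcompact : IsCompact ((fun s : ℝ => w₀ + s * Complex.I) '' Icc 0 (2 * Real.pi)) :=
    isCompact_Icc.image (by fun_prop)
  filter_upwards [hξC1.eventually_norm_sub_le (isOpen_puncturedDisk R) hε (isCompact_sphere 0 r)
      hsphere hκ,
    hΦC1.eventually_norm_sub_le (isOpen_cover R) hε hcompact (image_subset_iff.2 fun s _ => hline s)
      hκ, Ioo_mem_nhds h0mem.1 h0mem.2] with t hξt hΦt ht ht0
  obtain ⟨Ξ, hΞ, hξΞ⟩ := (hpole t ht ht0).exists_eq
  have hnorm := isNormalized_of_principalPart hR (hξ t ht) hΞ hξΞ (ha t ht ht0) (hb t ht ht0)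
  set M : LoopMatrix ρ := Φ t (w₀ + (2 * Real.pi : ℝ) * Complex.I) * (Φ t w₀).adjugate with hM
  obtain ⟨hU, hone, hderiv⟩ := (hmonodromy t ht ht0).of_deckTranslation (hΦSL t ht) hw₀ hM
  -- The regular part of the perturbation is `Ξ - N`, since the expansion is taken around the
  -- potential `N`.
  have hM1 := hexp (ξ t) (fun z => Ξ z - N) (fun s => Φ t (w₀ + s * Complex.I)) (Φ t w₀).adjugate
    (poleLoop (a t)) (poleLoop (b t)) (poleLoop (c t))
    ((hΞ.differentiableOn Metric.isOpen_ball).sub (differentiableOn_const N))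
    (fun z hz hzr => by
      rw [hξΞ z ⟨hz, hzr.trans_lt hrR⟩]
      abel)
    (fun z hz => by
      have h1 := hξt z (by simpa using hz)
      rwa [hcatenoid z (hsphere (by simpa using hz))] at h1)
    (fun s _ => (hΦ t ht).hasDerivAt hΦC1 ht hw₀ s)
    (fun s hs => by
      rw [← hφ0 s]
      exact hΦt _ (mem_image_of_mem _ hs))
    (by
      simp only [Complex.ofReal_zero, zero_mul, add_zero]
      rw [Matrix.adjugate_mul, hdet t ht w₀ hw₀, one_smul])
  rw [smul_residueTerm_poleLoop] at hM1
  set S := G * residueLoop (a t) (b t) (c t) * G' with hS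
  set τ := ‖a t‖ + ‖b t‖ + ‖c t‖ with hτ
  have hτ0 : 0 ≤ τ := by positivity
  have hτpole : ‖poleLoop (a t)‖ + ‖poleLoop (b t)‖ + ‖poleLoop (c t)‖ ≤ C₃ * τ := by
    have h1 := hpoleLoop (a t)
    have h2 := hpoleLoop (b t)
    have h3 := hpoleLoop (c t)
    rw [hτ, mul_add, mul_add]
    linarith
  have hS' : traceFree (S - (M - 1)) = S - traceFree M := by
    rw [traceFree_sub, traceFree_sub, traceFree_one, sub_zero,
      traceFree_eq_self (conj_residueLoop_apply_one_one hG'G _ _ _)]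
  have h1 : τ ≤ C₁ * defect S := hlower _ _ _ hnorm
  -- Subtracting the trace-free part of `M` leaves the defect unchanged, and the difference is the
  -- trace-free part of the expansion error, of size at most `η C₃ τ`.
  have h2 : defect S ≤ C₂ * (η * (C₃ * τ)) := by
    rw [← defect_sub_traceFree hU hone hderiv, ← hS']
    refine (hdefect _).trans (mul_le_mul_of_nonneg_left ?_ hC₂)
    rw [norm_sub_rev]
    exact hM1.trans (mul_le_mul_of_nonneg_left hτpole (by positivity))
  have h3 : τ ≤ 1 / 2 * τ := by
    calc τ ≤ C₁ * (C₂ * (η * (C₃ * τ))) := h1.trans (mul_le_mul_of_nonneg_left h2 hC₁)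
      _ = (C₁ * C₂ * C₃) * η * τ := by ring
      _ ≤ 1 / 2 * τ := by
          refine mul_le_mul_of_nonneg_right ?_ hτ0
          have h4 : 0 ≤ C₁ * C₂ * C₃ := by positivity
          rw [hη, ← div_eq_mul_inv, div_le_div_iff₀ (by positivity) two_pos]
          linarith
  have h4 := norm_nonneg (a t)
  have h5 := norm_nonneg (b t)
  have h6 := norm_nonneg (c t)
  exact ⟨norm_le_zero_iff.1 (by linarith), norm_le_zero_iff.1 (by linarith),
    norm_le_zero_iff.1 (by linarith)⟩

end DPW

end

theorem theorem2 {ρ R ε : ℝ} [Fact (1 < ρ)] (hR : 0 < R) (hε : 0 < ε)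
    (ξ Φ : ℝ → ℂ → DPW.LoopMatrix ρ) (w₀ : ℂ) (hw₀ : w₀ ∈ DPW.cover R)
    (a b c : ℝ → DPW.W ρ)
    (hξC1 : DPW.IsC1Family ε (DPW.puncturedDisk R) ξ)
    (hξ : ∀ t ∈ Set.Ioo (-ε) ε, DPW.IsDPWPotential (DPW.puncturedDisk R) (ξ t))
    (hΦC1 : DPW.IsC1Family ε (DPW.cover R) Φ)
    (hΦSL : ∀ t ∈ Set.Ioo (-ε) ε, ∀ w ∈ DPW.cover R, (Φ t w).IsSL)
    (hΦ : ∀ t ∈ Set.Ioo (-ε) ε, DPW.IsSolution R (ξ t) (Φ t))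
    (hcatenoid : ∀ z ∈ DPW.puncturedDisk R, ∀ lam : ℂ, ‖lam‖ = 1 →
      (ξ 0 z).eval lam = !![0, 0; 1, 0])
    (hpole : ∀ t ∈ Set.Ioo (-ε) ε, t ≠ 0 → DPW.HasPrincipalPart R (ξ t) (a t) (b t) (c t))
    (hannulus : ∃ ρ' : ℝ, ρ < ρ' ∧ (Φ 0 w₀).IsHolomorphicInAnnulus ρ')
    (hmonodromy : ∀ t ∈ Set.Ioo (-ε) ε, t ≠ 0 → DPW.SolvesMonodromyProblem R (Φ t))
    (ha : ∀ t ∈ Set.Ioo (-ε) ε, t ≠ 0 → (a t).coeff 0 = 0)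
    (hb : ∀ t ∈ Set.Ioo (-ε) ε, t ≠ 0 → ((b t).coeff 0).re = 0) :
    ∃ δ : ℝ, 0 < δ ∧ δ ≤ ε ∧ ∀ t ∈ Set.Ioo (-δ) δ,
      (t ≠ 0 → a t = 0 ∧ b t = 0 ∧ c t = 0) ∧
      ∃ Ξ : ℂ → DPW.LoopMatrix ρ, DPW.IsHolomorphicOn (Metric.ball 0 R) Ξ ∧
        ∀ z ∈ DPW.puncturedDisk R, ξ t z = Ξ z := by
  have hcat : ∀ z ∈ DPW.puncturedDisk R, ξ 0 z = DPW.LoopMatrix.catenoid := fun z hz =>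
    DPW.eq_catenoid_of_eval (hcatenoid z hz)
  obtain ⟨δ, hδ, hball⟩ := Metric.eventually_nhds_iff.1
    (DPW.eventually_principalPart_eq_zero hR hε hw₀ hξC1 hξ hΦC1 hΦSL hΦ hcat hpole hmonodromy
      ha hb)
  refine ⟨min δ ε, lt_min hδ hε, min_le_right _ _, fun t ht => ?_⟩
  have htδ : dist t 0 < δ := by
    rw [Real.dist_eq, sub_zero, abs_lt]
    exact ⟨(neg_le_neg (min_le_left _ _)).trans_lt ht.1, ht.2.trans_le (min_le_left _ _)⟩
  have htε : t ∈ Set.Ioo (-ε) ε :=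
    ⟨(neg_le_neg (min_le_right _ _)).trans_lt ht.1, ht.2.trans_le (min_le_right _ _)⟩
  refine ⟨fun ht0 => hball htδ ht0, ?_⟩
  -- At `t = 0` no principal part is given; the catenoid potential is constant in `z` and extends by
  -- itself.
  by_cases ht0 : t = 0
  · exact ⟨fun _ => DPW.LoopMatrix.catenoid, fun i j => differentiableOn_const _, fun z hz => by
      rw [ht0, hcat z hz]⟩
  · obtain ⟨Ξ, hΞ, hξΞ⟩ := (hpole t htε ht0).exists_eq
    obtain ⟨ha0, hb0, hc0⟩ := hball htδ ht0
    refine ⟨Ξ, hΞ, fun z hz => ?_⟩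
    rw [hξΞ z hz, ha0, hb0, hc0, DPW.LoopMatrix.poleLoop_zero]
    simp
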